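/- **Setting.** Let $A\in\mathbb{R}^{N\times d}$ have rank $r$ (so $r\le d$; if $A$ has full column rank, $r=d$), and let $Q=[q_1,\dots,q_r]\in\mathbb{R}^{N\times r}$ be any matrix whose columns form an orthonormal basis of $\operatorname{range}(A)$. Let $b,\tilde b\in\mathbb{R}^N\setminus\operatorname{range}(A)$, let $P_\perp$ be the orthogonal projection onto $\operatorname{range}(Q)^\perp$, write $a_{\mathcal P}=a/\|a\|_2$ for $a\ne0$ and $0_{\mathcal P}=0$, and put $$h=\big((P_\perp b)_{\mathcal P}-(P_\perp\tilde b)_{\mathcal P}\big)_{\mathcal P}.$$ Write $q_{ij}$ and $h_j$ for the $j$-th components of $q_i$ and $h$, and let $\ell_j=\sum_{k=1}^r q_{kj}^2$ be the leverage score of row $j$. Let $L\ge1$ be an integer. For $B\in\mathbb{R}^{N\times n}$, $c\in\mathbb{R}^N$ and $\varepsilon,\delta>0$, the distribution of a random matrix $S\in\mathbb{R}^{m\times N}$ *satisfies the $(\varepsilon,\delta)$ pair condition for $(B,c)$* if, with probability at least $1-\delta$, both $$\operatorname{rank}(SB)=\operatorname{rank}(B)\qquad\text{and}\qquad \|B\hat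 x-c\|_2\le(1+\varepsilon)\min_{x\in\mathbb{R}^n}\|Bx-c\|_2$$ hold, where $\hat x\in\operatorname{argmin}_x\|SBx-Sc\|_2$ (under the rank condition $B\hat x$ does not depend on the choice of minimizer). The sub-Gaussian norm of a real random variable $X$ is $\|X\|_{\psi_2}=\inf\{K>0:\mathbb{E}\exp(X^2/K^2)\le2\}$. **Theorem.** 1. There is an absolute constant $C>0$ such that the following holds for all $A,Q,b,\tilde b,L$ as above, all $\varepsilon,\delta\in(0,1]$ and all $K\ge1$. Suppose that the entries of $S\in\mathbb{R}^{m\times N}$ are i.i.d. sub-Gaussian with mean $0$ and variance $1/m$, and that the entries of $\sqrt m\,S$ have sub-Gaussian norm at most $K$. If $$m\ge\frac{CK^4}{\varepsilon}\,d\log\Big(\frac{4dL}{\delta}\Big),$$ then the distribution of $S$ satisfies the $(\varepsilon,\delta/L)$ pair condition for $(Q,h)$. 2. Let $0<\varepsilon,\delta<1/2$ and let $S\in\mathbb{R}^{m\times N}$ be the leverage score row sketch of $A$: $S_{ji}=\mathbf 1\{f(j)=i\}/\sqrt{m\,p_{f(j)}}$, where $f(1),\dots,f(m)$ are independent with $\Pr\{f(j)=i\}=p_i:=\ell_i/\sum_k\ell_k$.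 If $$m\ge\max\Big\{35\,d\log\Big(\frac{4dL}{\delta}\Big),\ \frac{2dL}{\varepsilon\delta}\Big\},$$ then the distribution of $S$ satisfies the $(\varepsilon,\delta/L)$ pair condition for $(Q,h)$. Moreover, if for some constant $C>0$ $$\max_{i\in[r]}\ \max_{j\in[N]:\,\ell_j>0}\ \frac{d\,|q_{ij}h_j|}{\ell_j}\le C,$$ then the same conclusion holds as soon as $$m\ge\max\Big\{35,\ \frac{4C^2}{\varepsilon}\Big\}\,d\log\Big(\frac{4dL}{\delta}\Big).$$ -/

import Mathlib

open MeasureTheory ProbabilityTheory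
open scoped ENNReal

noncomputable section

namespace SketchLS

/-- The optimal least squares residual `r(A, b) = min_x ‖A x - b‖₂` (the infimum is attained, the
range of `A` being closed). -/
def residual {N d : ℕ} (A : Matrix (Fin N) (Fin d) ℝ) (b : EuclideanSpace ℝ (Fin N)) : ℝ :=
  ⨅ x : EuclideanSpace ℝ (Fin d), ‖A.toEuclideanLin x - b‖

/-- `x` is a solution of the sketched problem, `x ∈ argmin_y ‖S A y - S b‖₂`. -/
def IsSketchedSolution {m N d : ℕ} (S : Matrix (Fin m) (Fin N) ℝ) (A : Matrix (Fin N) (Fin d) ℝ)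
    (b : EuclideanSpace ℝ (Fin N)) (x : EuclideanSpace ℝ (Fin d)) : Prop :=
  ∀ y : EuclideanSpace ℝ (Fin d),
    ‖(S * A).toEuclideanLin x - S.toEuclideanLin b‖ ≤
      ‖(S * A).toEuclideanLin y - S.toEuclideanLin b‖

/-- The two conditions on one sketch: `rank (S A) = rank A` and `r_S(A, b) ≤ (1 + ε) r(A, b)`, where
`r_S(A, b) = ‖A x̂ - b‖₂` for a solution `x̂` of the sketched problem. Solutions of the sketched
problem always exist; under the rank condition `A x̂` does not depend on which one is taken. -/
def IsGoodSketch {m N d : ℕ} (ε : ℝ) (A : Matrix (Fin N) (Fin d) ℝ)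
    (b : EuclideanSpace ℝ (Fin N)) (S : Matrix (Fin m) (Fin N) ℝ) : Prop :=
  (S * A).rank = A.rank ∧
    ∀ x : EuclideanSpace ℝ (Fin d), IsSketchedSolution S A b x →
      ‖A.toEuclideanLin x - b‖ ≤ (1 + ε) * residual A b

/-- The `(ε, δ)` pair condition for `(A, b)` of the random matrix `S` on `(Ω, μ)`: with probability
at least `1 - δ` both conditions hold simultaneously. -/
def PairCondition {Ω : Type*} [MeasurableSpace Ω] (μ : Measure Ω) {m N d : ℕ}
    (S : Ω → Matrix (Fin m) (Fin N) ℝ) (ε δ : ℝ) (A : Matrix (Fin N) (Fin d) ℝ)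
    (b : EuclideanSpace ℝ (Fin N)) : Prop :=
  ENNReal.ofReal (1 - δ) ≤ μ {ω | IsGoodSketch ε A b (S ω)}

/-- `Q = orth(A)`: the columns of `Q` form an orthonormal basis of the range of `A`. The number `r`
of columns is then the rank of `A`. -/
def IsOrth {N d r : ℕ} (A : Matrix (Fin N) (Fin d) ℝ) (Q : Matrix (Fin N) (Fin r) ℝ) : Prop :=
  Q.transpose * Q = 1 ∧ LinearMap.range Q.toEuclideanLin = LinearMap.range A.toEuclideanLin

/-- The vector `a` rescaled to unit length (and `0` for `a = 0`). -/
def normalize {N : ℕ} (a : EuclideanSpace ℝ (Fin N)) : EuclideanSpace ℝ (Fin N) :=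
  ‖a‖⁻¹ • a

/-- The orthogonal projection of `b` onto the orthogonal complement of the range of `Q`. -/
def projPerp {N r : ℕ} (Q : Matrix (Fin N) (Fin r) ℝ) (b : EuclideanSpace ℝ (Fin N)) :
    EuclideanSpace ℝ (Fin N) :=
  (LinearMap.range Q.toEuclideanLin)ᗮ.starProjection b

/-- The vector `h`: the normalized difference of the normalized projections of the high-fidelity
vector `b` and the low-fidelity vector `b'` onto the orthogonal complement of the range of `Q`. -/
def diffVec {N r : ℕ} (Q : Matrix (Fin N) (Fin r) ℝ) (b b' : EuclideanSpace ℝ (Fin N)) :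
    EuclideanSpace ℝ (Fin N) :=
  normalize (normalize (projPerp Q b) - normalize (projPerp Q b'))

/-- The sub-Gaussian norm `inf {K > 0 : E exp (X² / K²) ≤ 2}`, with values in `[0, ∞]`; it is `∞`
exactly if `X` is not sub-Gaussian. -/
def subGaussianNorm {Ω : Type*} [MeasurableSpace Ω] (X : Ω → ℝ) (μ : Measure Ω) : ℝ≥0∞ :=
  sInf {c : ℝ≥0∞ | ∃ K : ℝ, 0 < K ∧ c = ENNReal.ofReal K ∧
    ∫⁻ ω, ENNReal.ofReal (Real.exp (X ω ^ 2 / K ^ 2)) ∂μ ≤ 2}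

/-- `S` is a dense sub-Gaussian sketch with parameter `K`: its entries are i.i.d. with mean `0` and
variance `1 / m`, and the entries of `√m S` have sub-Gaussian norm at most `K`. -/
structure IsSubGaussianSketch {Ω : Type*} [MeasurableSpace Ω] (μ : Measure Ω) {m N : ℕ} (K : ℝ)
    (S : Ω → Matrix (Fin m) (Fin N) ℝ) : Prop where
  measurable : ∀ i j, Measurable fun ω => S ω i j
  indep : iIndepFun (fun (p : Fin m × Fin N) (ω : Ω) => S ω p.1 p.2) μ
  identDistrib : ∀ i j i' j', IdentDistrib (fun ω => S ω i j) (fun ω => S ω i' j') μ μ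
  mean_zero : ∀ i j, ∫ ω, S ω i j ∂μ = 0
  variance_eq : ∀ i j, variance (fun ω => S ω i j) μ = 1 / (m : ℝ)
  norm_le : ∀ i j, subGaussianNorm (fun ω => Real.sqrt m * S ω i j) μ ≤ ENNReal.ofReal K

/-- The leverage score of row `j` of a matrix `A` with `Q = orth(A)`: the squared norm of row `j`
of `Q`. It is the same for every orthonormal basis of the range of `A`. -/
def leverageScore {N r : ℕ} (Q : Matrix (Fin N) (Fin r) ℝ) (j : Fin N) : ℝ :=
  ∑ k, Q j k ^ 2

/-- The leverage score sampling probability of row `j`. -/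
def leverageProb {N r : ℕ} (Q : Matrix (Fin N) (Fin r) ℝ) (j : Fin N) : ℝ :=
  leverageScore Q j / ∑ i, leverageScore Q i

/-- `S` is the leverage score row sketch of a matrix `A` with `Q = orth(A)`: there are independent
random row indices `f j`, equal to `i` with probability `p_i`, and
`S_{ji} = 1{f j = i} / √(m p_{f j})`. -/
def IsLeverageScoreSketch {Ω : Type*} [MeasurableSpace Ω] (μ : Measure Ω) {m N r : ℕ}
    (Q : Matrix (Fin N) (Fin r) ℝ) (S : Ω → Matrix (Fin m) (Fin N) ℝ) : Prop :=
  ∃ f : Fin m → Ω → Fin N,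
    (∀ j, Measurable (f j)) ∧ iIndepFun f μ ∧
    (∀ j i, μ {ω | f j ω = i} = ENNReal.ofReal (leverageProb Q i)) ∧
    ∀ ω j i, S ω j i =
      if f j ω = i then 1 / Real.sqrt ((m : ℝ) * leverageProb Q (f j ω)) else 0

end SketchLS

end

/-! Since `Qᵀ h = 0`, Pythagoras gives `‖Q x - h‖² = ‖x‖² + ‖h‖²`. The optimal residual is thus
`‖h‖`, and it suffices that a sketched solution satisfies `‖x‖² ≤ 2 ε ‖h‖²`. If `‖S Q v‖² ≥ κ ‖v‖²`
for all `v`, the normal equations give `κ ‖x‖ ≤ ‖g‖` with `g = (S Q)ᵀ S h`. So two events are enough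
(`isGoodSketch_of_bounds`): a lower bound for the sketched Gram matrix with a fixed `κ`, which also
yields the rank condition, and `‖g‖² ≤ 2 ε κ² ‖h‖²`. The accuracy `ε` enters only through the square
of a centred quantity, whence `1/ε` rather than `1/ε²`.

Leverage scores, `κ = 3/5`: the Gram matrix is `r/m` times a sum of i.i.d. rank-one projections with
mean `1/r` times the identity. A matrix Chernoff bound (`sum_prod_trace_exp_le`), resting on
Golden–Thompson (`trace_exp_add_le`), controls it from below. The coordinates of `g` are averages of
i.i.d. centred variables: their second moments and Markov's inequality give the condition with
`2dL/(εδ)`, while Hoeffding's lemma gives the logarithmic condition when the summands are bounded.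

Sub-Gaussian entries, `κ = 1/2`: each sketched inner product is an average of independent
sub-exponential variables, so Bernstein's inequality applies
(`IsSubGaussianSketch.measureReal_abs_dotProduct_sub_ge_le`). It controls `g` coordinate by
coordinate, and the Gram matrix at the points of a grid, from which `half_le_of_gridNet` passes to
all vectors. The grid has about `r ^ r` points up to a factor exponential in `r`; this is affordable
because the target already contains `d log d`. -/

namespace SketchLS

open Matrix

/-! ### Deterministic criterion for a good sketch, and the vector `h`. -/

lemma inner_eq_zero_of_forall_norm_le_norm_add_smul {E : Type*} [NormedAddCommGroup E]
    [InnerProductSpace ℝ E] {u w : E} (h : ∀ t : ℝ, ‖u‖ ≤ ‖u + t • w‖) : inner ℝ u w = 0 := by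
  rcases eq_or_ne w 0 with rfl | hw
  · simp
  have hw' : 0 < ‖w‖ ^ 2 := by positivity
  -- The minimiser of the quadratic `t ↦ ‖u + t w‖²`.
  have h1 := h (-(inner ℝ u w) / ‖w‖ ^ 2)
  have h2 : ‖u‖ ^ 2 ≤ ‖u + (-(inner ℝ u w) / ‖w‖ ^ 2) • w‖ ^ 2 := by gcongr
  rw [norm_add_sq_real, inner_smul_right, norm_smul, mul_pow, Real.norm_eq_abs, sq_abs] at h2
  have h3 : 2 * (-(inner ℝ u w) / ‖w‖ ^ 2 * inner ℝ u w)
      + (-(inner ℝ u w) / ‖w‖ ^ 2) ^ 2 * ‖w‖ ^ 2 = -((inner ℝ u w) ^ 2 / ‖w‖ ^ 2) := by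
    field_simp
    ring
  have h4 : (inner ℝ u w) ^ 2 / ‖w‖ ^ 2 ≤ 0 := by linarith
  have h5 : (inner ℝ u w) ^ 2 ≤ 0 := by
    by_contra hc
    push Not at hc
    have := div_pos hc hw'
    linarith
  exact pow_eq_zero_iff (two_ne_zero) |>.1 (le_antisymm h5 (sq_nonneg _))

lemma norm_sq_eq_dotProduct {n : ℕ} (v : EuclideanSpace ℝ (Fin n)) :
    ‖v‖ ^ 2 = v.ofLp ⬝ᵥ v.ofLp := by
  rw [EuclideanSpace.norm_sq_eq]
  simp [dotProduct, sq]

lemma dotProduct_mulVec_of_orthonormal {N r : ℕ} {Q : Matrix (Fin N) (Fin r) ℝ} (hQ : Qᵀ * Q = 1)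
    (v : Fin r → ℝ) : (Q *ᵥ v) ⬝ᵥ (Q *ᵥ v) = v ⬝ᵥ v := by
  rw [dotProduct_mulVec, ← mulVec_transpose, mulVec_mulVec, hQ, one_mulVec]

/-- A coercive quadratic form forces a trivial kernel. With `κ = 1` this also computes the rank of
`Q` itself. -/
lemma rank_eq_of_lower_bound {p q : ℕ} {M : Matrix (Fin p) (Fin q) ℝ} {κ : ℝ} (hκ : 0 < κ)
    (h : ∀ v : Fin q → ℝ, κ * (v ⬝ᵥ v) ≤ (M *ᵥ v) ⬝ᵥ (M *ᵥ v)) : M.rank = q := by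
  have hinj : Function.Injective M.mulVecLin := by
    rw [← LinearMap.ker_eq_bot, LinearMap.ker_eq_bot']
    intro v hv
    have hv' : M *ᵥ v = 0 := hv
    have h1 := h v
    rw [hv', zero_dotProduct] at h1
    have h2 : v ⬝ᵥ v ≤ 0 := by
      by_contra hc
      push Not at hc
      have := mul_pos hκ hc
      linarith
    have h3 : 0 ≤ v ⬝ᵥ v := Finset.sum_nonneg fun i _ => mul_self_nonneg _
    exact dotProduct_self_eq_zero.1 (le_antisymm h2 h3)
  rw [Matrix.rank, LinearMap.finrank_range_of_inj hinj]
  simp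

/-- A lower bound for the sketched Gram matrix and an upper bound for the sketched correlation of
the columns of `Q` with `h` make `S` a good sketch for `(Q, h)`. -/
theorem isGoodSketch_of_bounds {m N r : ℕ} {S : Matrix (Fin m) (Fin N) ℝ}
    {Q : Matrix (Fin N) (Fin r) ℝ} {h : EuclideanSpace ℝ (Fin N)} {ε κ : ℝ} (hε : 0 ≤ ε)
    (hκ : 0 < κ) (hQ : Qᵀ * Q = 1) (hh : Qᵀ *ᵥ h.ofLp = 0)
    (h1 : ∀ v : Fin r → ℝ, κ * (v ⬝ᵥ v) ≤ ((S * Q) *ᵥ v) ⬝ᵥ ((S * Q) *ᵥ v))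
    (h2 : ∑ k, (((S * Q)ᵀ *ᵥ (S *ᵥ h.ofLp)) k) ^ 2 ≤ 2 * ε * κ ^ 2 * (h.ofLp ⬝ᵥ h.ofLp)) :
    IsGoodSketch ε Q h S := by
  have pyth : ∀ x : EuclideanSpace ℝ (Fin r),
      ‖Q.toEuclideanLin x - h‖ ^ 2 = x.ofLp ⬝ᵥ x.ofLp + h.ofLp ⬝ᵥ h.ofLp := by
    intro x
    rw [norm_sq_eq_dotProduct]
    have e : (Q.toEuclideanLin x - h).ofLp = Q *ᵥ x.ofLp - h.ofLp := rfl
    have e2 : (Q *ᵥ x.ofLp) ⬝ᵥ h.ofLp = 0 := by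
      rw [dotProduct_comm, dotProduct_mulVec, ← mulVec_transpose, hh, zero_dotProduct]
    rw [e, sub_dotProduct, dotProduct_sub, dotProduct_sub, dotProduct_mulVec_of_orthonormal hQ,
      dotProduct_comm h.ofLp, e2]
    ring
  refine ⟨?_, fun x hx => ?_⟩
  · rw [rank_eq_of_lower_bound hκ h1]
    refine (rank_eq_of_lower_bound one_pos fun v => ?_).symm
    rw [one_mul, dotProduct_mulVec_of_orthonormal hQ]
  have hres : ‖h‖ ≤ residual Q h := by
    refine le_ciInf fun y => ?_
    refine le_of_sq_le_sq ?_ (norm_nonneg _)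
    rw [pyth, norm_sq_eq_dotProduct]
    have : 0 ≤ y.ofLp ⬝ᵥ y.ofLp := Finset.sum_nonneg fun i _ => mul_self_nonneg _
    linarith
  -- Varying `x` along its own direction yields the only consequence of the normal equations that is
  -- needed.
  have hne : inner ℝ ((S * Q).toEuclideanLin x - S.toEuclideanLin h) ((S * Q).toEuclideanLin x)
      = 0 := by
    refine inner_eq_zero_of_forall_norm_le_norm_add_smul fun t => ?_
    refine (hx (x + t • x)).trans_eq ?_
    rw [map_add, map_smul]
    congr 1
    abel
  set g : Fin r → ℝ := (S * Q)ᵀ *ᵥ (S *ᵥ h.ofLp) with hg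
  have hne' : ((S * Q) *ᵥ x.ofLp) ⬝ᵥ ((S * Q) *ᵥ x.ofLp) = x.ofLp ⬝ᵥ g := by
    rw [inner_sub_left, sub_eq_zero] at hne
    have e1 : inner ℝ ((S * Q).toEuclideanLin x) ((S * Q).toEuclideanLin x)
        = ((S * Q) *ᵥ x.ofLp) ⬝ᵥ ((S * Q) *ᵥ x.ofLp) := rfl
    have e2 : inner ℝ (S.toEuclideanLin h) ((S * Q).toEuclideanLin x)
        = ((S * Q) *ᵥ x.ofLp) ⬝ᵥ (S *ᵥ h.ofLp) := rfl
    rw [← e1, hne, e2, hg, dotProduct_mulVec x.ofLp, vecMul_transpose]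
  have hb := h1 x.ofLp
  rw [hne'] at hb
  have hcs : (x.ofLp ⬝ᵥ g) ^ 2 ≤ (x.ofLp ⬝ᵥ x.ofLp) * ∑ k, g k ^ 2 := by
    have := Finset.sum_mul_sq_le_sq_mul_sq Finset.univ x.ofLp g
    simpa [dotProduct, sq] using this
  set a := x.ofLp ⬝ᵥ x.ofLp with ha
  have ha0 : 0 ≤ a := Finset.sum_nonneg fun i _ => mul_self_nonneg _
  have hab : a ≤ 2 * ε * (h.ofLp ⬝ᵥ h.ofLp) := by
    have hH : 0 ≤ h.ofLp ⬝ᵥ h.ofLp := Finset.sum_nonneg fun i _ => mul_self_nonneg _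
    rcases ha0.eq_or_lt with h0 | h0
    · rw [← h0]
      positivity
    have h3 : (κ * a) ^ 2 ≤ a * (2 * ε * κ ^ 2 * (h.ofLp ⬝ᵥ h.ofLp)) :=
      calc (κ * a) ^ 2 ≤ (x.ofLp ⬝ᵥ g) ^ 2 := by gcongr
        _ ≤ a * ∑ k, g k ^ 2 := hcs
        _ ≤ _ := by gcongr
    have h4 : (κ ^ 2 * a) * a ≤ (κ ^ 2 * a) * (2 * ε * (h.ofLp ⬝ᵥ h.ofLp)) := by
      calc _ = (κ * a) ^ 2 := by ring
        _ ≤ _ := h3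
        _ = _ := by ring
    exact le_of_mul_le_mul_left h4 (by positivity)
  -- The factor 2 in the correlation hypothesis is the one in `1 + 2 ε ≤ (1 + ε)²`.
  calc ‖Q.toEuclideanLin x - h‖ ≤ (1 + ε) * ‖h‖ := by
        refine le_of_sq_le_sq ?_ (by positivity)
        rw [pyth, mul_pow, norm_sq_eq_dotProduct]
        have hH : 0 ≤ h.ofLp ⬝ᵥ h.ofLp := Finset.sum_nonneg fun i _ => mul_self_nonneg _
        nlinarith [mul_nonneg (sq_nonneg ε) hH]
    _ ≤ (1 + ε) * residual Q h := by gcongr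

lemma transpose_mulVec_diffVec {N r : ℕ} (Q : Matrix (Fin N) (Fin r) ℝ)
    (b b' : EuclideanSpace ℝ (Fin N)) : Qᵀ *ᵥ (diffVec Q b b').ofLp = 0 := by
  have hmem : diffVec Q b b' ∈ (LinearMap.range Q.toEuclideanLin)ᗮ := by
    have hp : ∀ c, projPerp Q c ∈ (LinearMap.range Q.toEuclideanLin)ᗮ := fun c =>
      Submodule.starProjection_apply_mem _ _
    exact Submodule.smul_mem _ _ (Submodule.sub_mem _ (Submodule.smul_mem _ _ (hp _))
      (Submodule.smul_mem _ _ (hp _)))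
  have key : ∀ v : Fin r → ℝ, v ⬝ᵥ (Qᵀ *ᵥ (diffVec Q b b').ofLp) = 0 := by
    intro v
    have := (Submodule.mem_orthogonal _ _).1 hmem (Q.toEuclideanLin (WithLp.toLp 2 v)) ⟨_, rfl⟩
    have e : inner ℝ (Q.toEuclideanLin (WithLp.toLp 2 v)) (diffVec Q b b')
        = (diffVec Q b b').ofLp ⬝ᵥ (Q *ᵥ v) := rfl
    rw [e] at this
    rw [dotProduct_mulVec, vecMul_transpose, dotProduct_comm, this]
  exact dotProduct_self_eq_zero.1 (key _)

/-- The zero case occurs when the two normalized projections coincide; the correlation bound is then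
trivial and only the Gram event matters. -/
lemma diffVec_dotProduct_self {N r : ℕ} (Q : Matrix (Fin N) (Fin r) ℝ)
    (b b' : EuclideanSpace ℝ (Fin N)) : diffVec Q b b' = 0 ∨
      (diffVec Q b b').ofLp ⬝ᵥ (diffVec Q b b').ofLp = 1 := by
  rw [← norm_sq_eq_dotProduct]
  unfold diffVec
  set u := normalize (projPerp Q b) - normalize (projPerp Q b') with hu
  rcases eq_or_ne u 0 with h0 | h0
  · left
    rw [h0]
    simp [normalize]
  · right
    have : ‖u‖ ≠ 0 := norm_ne_zero_iff.2 h0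
    simp [normalize, norm_smul, this]

/-- The probability estimates are in terms of `r`, the sample sizes in terms of `d`. -/
lemma rank_le_of_isOrth {N d r : ℕ} {A : Matrix (Fin N) (Fin d) ℝ} {Q : Matrix (Fin N) (Fin r) ℝ}
    (h : IsOrth A Q) : r ≤ d := by
  have hinj : Function.Injective Q.toEuclideanLin := by
    intro x y hxy
    have e : Q *ᵥ x.ofLp = Q *ᵥ y.ofLp := congrArg WithLp.ofLp hxy
    have e2 : Qᵀ *ᵥ (Q *ᵥ x.ofLp) = Qᵀ *ᵥ (Q *ᵥ y.ofLp) := by rw [e]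
    rw [mulVec_mulVec, mulVec_mulVec, h.1, one_mulVec, one_mulVec] at e2
    exact WithLp.ofLp_injective 2 e2
  have h1 := LinearMap.finrank_range_of_inj hinj
  rw [h.2, finrank_euclideanSpace_fin] at h1
  have h2 := LinearMap.finrank_range_le A.toEuclideanLin
  rw [h1, finrank_euclideanSpace_fin] at h2
  exact h2

/-! ### The Golden–Thompson trace inequality. -/

section GoldenThompson

variable {n : Type*} [Fintype n]

/-- Expand `tr ((A - Bᵀ)(A - Bᵀ)ᵀ) ≥ 0`. -/
lemma trace_mul_le_half (A B : Matrix n n ℝ) :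
    (A * B).trace ≤ ((A * Aᵀ).trace + (Bᵀ * B).trace) / 2 := by
  have key : ∀ C : Matrix n n ℝ, 0 ≤ (C * Cᵀ).trace := fun C => by
    rw [trace]
    refine Finset.sum_nonneg fun i _ => ?_
    rw [diag_apply, mul_apply]
    exact Finset.sum_nonneg fun j _ => by rw [transpose_apply]; exact mul_self_nonneg _
  have h := key (A - Bᵀ)
  rw [transpose_sub, transpose_transpose, sub_mul, mul_sub, mul_sub, trace_sub, trace_sub,
    trace_sub, ← trace_transpose (Bᵀ * Aᵀ), transpose_mul, transpose_transpose,
    transpose_transpose] at h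
  linarith

variable [DecidableEq n]

lemma trace_mul_pow_comm (A B : Matrix n n ℝ) (k : ℕ) :
    ((A * B) ^ k).trace = ((B * A) ^ k).trace := by
  cases k with
  | zero => simp
  | succ k =>
    have h : ∀ k : ℕ, (A * B) ^ k * A = A * (B * A) ^ k := by
      intro k
      induction k with
      | zero => simp
      | succ k ih => rw [pow_succ', mul_assoc, ih, pow_succ']; simp only [mul_assoc]
    rw [pow_succ, ← mul_assoc, h, mul_assoc, trace_mul_comm, mul_assoc, ← pow_succ]

/-- Two trace inequalities for powers with exponent `2 ^ k`, proved together. -/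
lemma trace_pow_two_pow_le (k : ℕ) :
    (∀ M : Matrix n n ℝ, (M ^ 2 ^ (k + 1)).trace ≤ ((M * Mᵀ) ^ 2 ^ k).trace) ∧
    (∀ X Y : Matrix n n ℝ, Xᵀ = X → Yᵀ = Y →
      ((X * Y) ^ 2 ^ k).trace ≤ (X ^ 2 ^ k * Y ^ 2 ^ k).trace) := by
  induction k with
  | zero =>
    refine ⟨fun M => ?_, fun X Y _ _ => by simp⟩
    have h := trace_mul_le_half M M
    rw [trace_mul_comm Mᵀ M] at h
    simp only [zero_add, pow_one, pow_zero, sq]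
    linarith
  | succ k ih =>
    obtain ⟨ihP, ihQ⟩ := ih
    refine ⟨fun M => ?_, fun X Y hX hY => ?_⟩
    -- The first inequality at level `k`, applied to `M²`, leads by cyclicity to the product of the
    -- symmetric matrices `M Mᵀ` and `Mᵀ M`. The second inequality separates their powers, and both
    -- resulting squares have the same trace.
    · have hs : ∀ P : Matrix n n ℝ, Pᵀ = P → (P ^ 2 ^ k)ᵀ = P ^ 2 ^ k := fun P hP => by
        rw [transpose_pow, hP]
      have hP : (M * Mᵀ)ᵀ = M * Mᵀ := by simp
      have hQ : (Mᵀ * M)ᵀ = Mᵀ * M := by simp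
      calc (M ^ 2 ^ (k + 1 + 1)).trace = ((M * M) ^ 2 ^ (k + 1)).trace := by
            rw [pow_succ' 2 (k + 1), pow_mul, sq]
        _ ≤ ((M * M * (M * M)ᵀ) ^ 2 ^ k).trace := ihP _
        _ = ((M * (M * Mᵀ * Mᵀ)) ^ 2 ^ k).trace := by rw [transpose_mul]; simp only [mul_assoc]
        _ = (((M * Mᵀ) * (Mᵀ * M)) ^ 2 ^ k).trace := by
            rw [trace_mul_pow_comm]; simp only [mul_assoc]
        _ ≤ ((M * Mᵀ) ^ 2 ^ k * (Mᵀ * M) ^ 2 ^ k).trace := ihQ _ _ hP hQ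
        _ ≤ (((M * Mᵀ) ^ 2 ^ k * ((M * Mᵀ) ^ 2 ^ k)ᵀ).trace
            + (((Mᵀ * M) ^ 2 ^ k)ᵀ * (Mᵀ * M) ^ 2 ^ k).trace) / 2 := trace_mul_le_half _ _
        _ = ((M * Mᵀ) ^ 2 ^ (k + 1)).trace := by
            rw [hs _ hP, hs _ hQ, ← sq, ← sq, ← pow_mul, ← pow_mul, ← pow_succ,
              trace_mul_pow_comm Mᵀ M]
            ring
    -- The first inequality at level `k` and cyclicity replace `X`, `Y` by `X²`, `Y²`, to which the
    -- second one applies.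
    · calc ((X * Y) ^ 2 ^ (k + 1)).trace ≤ ((X * Y * (X * Y)ᵀ) ^ 2 ^ k).trace := ihP _
        _ = ((X * (Y * Y * X)) ^ 2 ^ k).trace := by
            rw [transpose_mul, hX, hY]; simp only [mul_assoc]
        _ = (((Y * Y) * (X * X)) ^ 2 ^ k).trace := by
            rw [trace_mul_pow_comm]; simp only [mul_assoc]
        _ = (((X * X) * (Y * Y)) ^ 2 ^ k).trace := trace_mul_pow_comm _ _ _
        _ ≤ ((X * X) ^ 2 ^ k * (Y * Y) ^ 2 ^ k).trace :=
            ihQ _ _ (by rw [transpose_mul, hX]) (by rw [transpose_mul, hY])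
        _ = (X ^ 2 ^ (k + 1) * Y ^ 2 ^ (k + 1)).trace := by
            rw [← sq, ← sq, ← pow_mul, ← pow_mul, ← pow_succ']

open Filter Topology NormedSpace in
/-- The Lie product formula. -/
lemma tendsto_exp_mul_exp_pow {𝔸 : Type*} [NormedRing 𝔸] [NormedAlgebra ℝ 𝔸] [NormOneClass 𝔸]
    [CompleteSpace 𝔸] (A B : 𝔸) :
    Tendsto (fun k : ℕ => (exp ((k : ℝ)⁻¹ • A) * exp ((k : ℝ)⁻¹ • B)) ^ k) atTop
      (𝓝 (exp (A + B))) := by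
  let : NormedAlgebra ℚ 𝔸 := NormedAlgebra.restrictScalars ℚ ℝ 𝔸
  have hexp : ∀ x : 𝔸, ‖exp x‖ ≤ Real.exp ‖x‖ := fun x => by
    rw [exp_eq_tsum ℝ, Real.exp_eq_exp_ℝ]
    refine tsum_of_norm_bounded (exp_series_hasSum_exp' (𝕂 := ℝ) ‖x‖) fun k => ?_
    rw [norm_smul, smul_eq_mul, Real.norm_of_nonneg (by positivity)]
    gcongr
    exact norm_pow_le _ _
  -- Telescoping bound: a per-factor error is amplified at most `k` times, up to powers of the norm
  -- bound.
  have hpow : ∀ (c : ℝ) (X Y : 𝔸), ‖X‖ ≤ c → ‖Y‖ ≤ c → ∀ k : ℕ,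
      ‖X ^ k - Y ^ k‖ ≤ k * c ^ (k - 1) * ‖X - Y‖ := by
    intro c X Y hX hY k
    have hc : 0 ≤ c := (norm_nonneg _).trans hX
    induction k with
    | zero => simp
    | succ k ih =>
      rcases k with _ | k
      · simp
      have e : X ^ (k + 1 + 1) - Y ^ (k + 1 + 1)
          = X * (X ^ (k + 1) - Y ^ (k + 1)) + (X - Y) * Y ^ (k + 1) := by
        rw [pow_succ' X, pow_succ' Y (k + 1)]
        noncomm_ring
      rw [e]
      calc _ ≤ ‖X‖ * ‖X ^ (k + 1) - Y ^ (k + 1)‖ + ‖X - Y‖ * ‖Y‖ ^ (k + 1) := by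
            refine (norm_add_le _ _).trans (add_le_add (norm_mul_le _ _) ?_)
            exact (norm_mul_le _ _).trans (by gcongr; exact norm_pow_le _ _)
        _ ≤ c * (((k + 1 : ℕ) : ℝ) * c ^ k * ‖X - Y‖) + ‖X - Y‖ * c ^ (k + 1) := by
            gcongr
            simpa using ih
        _ = _ := by
            simp only [Nat.add_sub_cancel]
            push_cast
            ring
  -- The product of exponentials and the exponential of the sum agree to first order at 0. At `t =
  -- 1/k` they differ by `o(1/k)`, which survives multiplication by `k`.
  have hder : HasDerivAt (fun t : ℝ => exp (t • A) * exp (t • B) - exp (t • (A + B))) 0 0 := by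
    have hA := hasDerivAt_exp_smul_const (𝕂 := ℝ) A (0 : ℝ)
    have hB := hasDerivAt_exp_smul_const (𝕂 := ℝ) B (0 : ℝ)
    have hAB := hasDerivAt_exp_smul_const (𝕂 := ℝ) (A + B) (0 : ℝ)
    refine ((hA.mul hB).sub hAB).congr_deriv ?_
    simp
  have hlim : Tendsto (fun k : ℕ => (k : ℝ) *
      ‖exp ((k : ℝ)⁻¹ • A) * exp ((k : ℝ)⁻¹ • B) - exp ((k : ℝ)⁻¹ • (A + B))‖) atTop (𝓝 0) := by
    have h0 : Tendsto (fun k : ℕ => (k : ℝ)⁻¹) atTop (𝓝[≠] 0) := by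
      refine tendsto_nhdsWithin_iff.2 ⟨tendsto_inv_atTop_zero.comp tendsto_natCast_atTop_atTop, ?_⟩
      filter_upwards [eventually_gt_atTop 0] with k hk
      have : (k : ℝ) ≠ 0 := by positivity
      simpa using this
    have h1 := (hasDerivAt_iff_tendsto_slope.1 hder).comp h0
    have h2 := h1.norm
    simp only [norm_zero] at h2
    refine h2.congr fun k => ?_
    simp [slope_def_module, norm_smul]
  rw [tendsto_iff_norm_sub_tendsto_zero]
  have hfin := hlim.mul_const (Real.exp (‖A‖ + ‖B‖))
  rw [zero_mul] at hfin
  refine squeeze_zero' (Eventually.of_forall fun _ => norm_nonneg _) ?_ hfin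
  filter_upwards [eventually_gt_atTop 0] with k hk
  have hk' : (0 : ℝ) < k := by exact_mod_cast hk
  set c := Real.exp ((k : ℝ)⁻¹ * (‖A‖ + ‖B‖)) with hc
  have hns : ∀ x : 𝔸, ‖(k : ℝ)⁻¹ • x‖ = (k : ℝ)⁻¹ * ‖x‖ := fun x => by
    rw [norm_smul, norm_inv, Real.norm_natCast]
  have hX : ‖exp ((k : ℝ)⁻¹ • A) * exp ((k : ℝ)⁻¹ • B)‖ ≤ c := by
    refine (norm_mul_le _ _).trans ?_
    rw [hc, mul_add, Real.exp_add, ← hns, ← hns]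
    exact mul_le_mul (hexp _) (hexp _) (norm_nonneg _) (Real.exp_pos _).le
  have hY : ‖exp ((k : ℝ)⁻¹ • (A + B))‖ ≤ c := by
    refine (hexp _).trans (Real.exp_le_exp.2 ?_)
    rw [hns]
    gcongr
    exact norm_add_le _ _
  have hYk : exp (A + B) = exp ((k : ℝ)⁻¹ • (A + B)) ^ k := by
    rw [← NormedSpace.exp_nsmul, ← Nat.cast_smul_eq_nsmul ℝ, smul_smul, mul_inv_cancel₀ hk'.ne', one_smul]
  rw [hYk]
  refine (hpow c _ _ hX hY k).trans ?_
  have hck : c ^ (k - 1) ≤ Real.exp (‖A‖ + ‖B‖) := by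
    rw [hc, ← Real.exp_nat_mul]
    refine Real.exp_le_exp.2 ?_
    rw [← mul_assoc]
    have : ((k - 1 : ℕ) : ℝ) * (k : ℝ)⁻¹ ≤ 1 := by
      rw [← div_eq_mul_inv, div_le_one hk']
      exact_mod_cast Nat.sub_le _ _
    exact mul_le_of_le_one_left (by positivity) this
  calc _ ≤ k * Real.exp (‖A‖ + ‖B‖) *
        ‖exp ((k : ℝ)⁻¹ • A) * exp ((k : ℝ)⁻¹ • B) - exp ((k : ℝ)⁻¹ • (A + B))‖ := by gcongr
    _ = _ := by ring

open NormedSpace Filter Topology in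
/-- The **Golden–Thompson inequality** for real symmetric matrices. -/
theorem trace_exp_add_le (A B : Matrix n n ℝ) (hA : Aᵀ = A) (hB : Bᵀ = B) :
    (exp (A + B)).trace ≤ (exp A * exp B).trace := by
  rcases isEmpty_or_nonempty n with hn | hn
  · simp [trace]
  have hlim : Tendsto (fun k : ℕ => (exp ((k : ℝ)⁻¹ • A) * exp ((k : ℝ)⁻¹ • B)) ^ k) atTop
      (𝓝 (exp (A + B))) := by
    let : NormedRing (Matrix n n ℝ) := Matrix.linftyOpNormedRing
    let : NormedAlgebra ℝ (Matrix n n ℝ) := Matrix.linftyOpNormedAlgebra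
    have : NormOneClass (Matrix n n ℝ) := Matrix.linfty_opNormOneClass
    have : CompleteSpace (Matrix n n ℝ) := FiniteDimensional.complete ℝ _
    exact tendsto_exp_mul_exp_pow A B
  -- The trace inequality is available for exponents `2 ^ k` only, so the limit is taken along this
  -- subsequence.
  have h2 : Tendsto (fun k : ℕ => 2 ^ k) atTop (atTop : Filter ℕ) :=
    tendsto_pow_atTop_atTop_of_one_lt one_lt_two
  have htr : Continuous fun M : Matrix n n ℝ => M.trace := continuous_id.matrix_trace
  refine le_of_tendsto ((htr.tendsto _).comp (hlim.comp h2)) (Eventually.of_forall fun k => ?_)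
  have hs : ∀ M : Matrix n n ℝ, exp (((2 ^ k : ℕ) : ℝ)⁻¹ • M) ^ 2 ^ k = exp M := fun M => by
    rw [← Matrix.exp_nsmul, ← Nat.cast_smul_eq_nsmul ℝ, smul_smul, mul_inv_cancel₀ (by positivity),
      one_smul]
  have ht : ∀ M : Matrix n n ℝ, Mᵀ = M →
      (exp (((2 ^ k : ℕ) : ℝ)⁻¹ • M))ᵀ = exp (((2 ^ k : ℕ) : ℝ)⁻¹ • M) := fun M hM => by
    rw [← Matrix.exp_transpose, transpose_smul, hM]
  have := (trace_pow_two_pow_le k).2 _ _ (ht A hA) (ht B hB)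
  rwa [hs, hs] at this

end GoldenThompson

/-! ### Moments of sums of i.i.d. samples from a finite set, written as finite sums. -/

section FiniteProduct

variable {ι : Type*} [Fintype ι] (p : ι → ℝ)

/-- Conditioning on the first sample; every moment below follows from it by induction on the number
of samples. -/
lemma sum_prod_mul_succ {k : ℕ} (φ : (Fin (k + 1) → ι) → ℝ) :
    ∑ g : Fin (k + 1) → ι, (∏ j, p (g j)) * φ g
      = ∑ i, p i * ∑ g : Fin k → ι, (∏ j, p (g j)) * φ (Fin.cons i g) := by
  rw [← (Fin.consEquiv fun _ : Fin (k + 1) => ι).sum_comp, Fintype.sum_prod_type]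
  refine Finset.sum_congr rfl fun i _ => ?_
  rw [Finset.mul_sum]
  refine Finset.sum_congr rfl fun g _ => ?_
  simp [Fin.consEquiv, Fin.prod_univ_succ, mul_assoc]

variable {p}

lemma sum_prod_eq_one (hp1 : ∑ i, p i = 1) (k : ℕ) : ∑ g : Fin k → ι, ∏ j, p (g j) = 1 := by
  induction k with
  | zero => simp
  | succ k ih =>
    have := sum_prod_mul_succ p (k := k) fun _ => 1
    simp only [mul_one] at this
    rw [this, ih]
    simpa using hp1

/-- The second moment of a sum of i.i.d. centred random variables. -/
lemma sum_prod_mul_sum_sq (hp1 : ∑ i, p i = 1) (x : ι → ℝ) (hx : ∑ i, p i * x i = 0) (k : ℕ) :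
    ∑ g : Fin k → ι, (∏ j, p (g j)) * (∑ j, x (g j)) ^ 2 = k * ∑ i, p i * x i ^ 2 := by
  induction k with
  | zero => simp
  | succ k ih =>
    rw [sum_prod_mul_succ]
    have e : ∀ i, ∑ g : Fin k → ι, (∏ j, p (g j)) *
        (∑ j, x ((Fin.cons i g : Fin (k + 1) → ι) j)) ^ 2
        = x i ^ 2 + x i * (2 * ∑ g : Fin k → ι, (∏ j, p (g j)) * ∑ j, x (g j))
          + k * ∑ i, p i * x i ^ 2 := by
      intro i
      rw [← ih]
      simp only [Fin.sum_univ_succ, Fin.cons_zero, Fin.cons_succ]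
      rw [Finset.mul_sum, Finset.mul_sum, ← mul_one (x i ^ 2), ← sum_prod_eq_one hp1 k,
        Finset.mul_sum, ← Finset.sum_add_distrib, ← Finset.sum_add_distrib]
      exact Finset.sum_congr rfl fun g _ => by ring
    simp only [e, mul_add, Finset.sum_add_distrib, ← mul_assoc, ← Finset.sum_mul, hx, hp1]
    push_cast
    ring

lemma sum_prod_mul_exp_sum (x : ι → ℝ) (k : ℕ) :
    ∑ g : Fin k → ι, (∏ j, p (g j)) * Real.exp (∑ j, x (g j))
      = (∑ i, p i * Real.exp (x i)) ^ k := by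
  induction k with
  | zero => simp
  | succ k ih =>
    rw [sum_prod_mul_succ, pow_succ, ← ih, mul_comm, Finset.sum_mul]
    refine Finset.sum_congr rfl fun i _ => ?_
    rw [mul_assoc]
    congr 1
    rw [Finset.mul_sum]
    refine Finset.sum_congr rfl fun g _ => ?_
    simp only [Fin.sum_univ_succ, Fin.cons_zero, Fin.cons_succ, Real.exp_add]
    ring

/-- **Hoeffding's lemma** for a finitely supported centred distribution. -/
lemma sum_mul_exp_le (hp : ∀ i, 0 ≤ p i) (hp1 : ∑ i, p i = 1) {x : ι → ℝ}
    (hx : ∑ i, p i * x i = 0) {C : ℝ} (hC : 0 < C) (hxC : ∀ i, 0 < p i → |x i| ≤ C) (t : ℝ) :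
    ∑ i, p i * Real.exp (t * x i) ≤ Real.exp ((t * C) ^ 2 / 2) := by
  have h1 : ∀ i, p i * Real.exp (t * x i)
      ≤ p i * (Real.cosh (t * C) + x i / C * Real.sinh (t * C)) := by
    intro i
    rcases (hp i).eq_or_lt with h0 | h0
    · simp [← h0]
    have hb := abs_le.1 (hxC i h0)
    have hb1 : x i / C ≤ 1 := (div_le_one hC).2 hb.2
    have hb2 : -1 ≤ x i / C := by rw [le_div_iff₀ hC]; linarith
    -- The exponential lies below its chord on `[-tC, tC]`; the part of the chord linear in `x i`
    -- averages to zero and leaves `cosh (t C)`.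
    have hcv := convexOn_exp.2 (Set.mem_univ (t * C)) (Set.mem_univ (-(t * C)))
      (show 0 ≤ (1 + x i / C) / 2 by linarith) (show 0 ≤ (1 - x i / C) / 2 by linarith) (by ring)
    have e : ((1 + x i / C) / 2) • (t * C) + ((1 - x i / C) / 2) • (-(t * C)) = t * x i := by
      simp only [smul_eq_mul]
      field_simp
      ring
    rw [e] at hcv
    refine mul_le_mul_of_nonneg_left (hcv.trans_eq ?_) h0.le
    rw [Real.cosh_eq, Real.sinh_eq]
    simp only [smul_eq_mul]
    ring
  refine (Finset.sum_le_sum fun i _ => h1 i).trans ?_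
  have e : ∑ i, p i * (Real.cosh (t * C) + x i / C * Real.sinh (t * C)) = Real.cosh (t * C) := by
    have : ∀ i, p i * (Real.cosh (t * C) + x i / C * Real.sinh (t * C))
        = p i * Real.cosh (t * C) + p i * x i * (Real.sinh (t * C) / C) := fun i => by ring
    simp only [this, Finset.sum_add_distrib, ← Finset.sum_mul, hx, hp1]
    ring
  rw [e]
  exact Real.cosh_le_exp_half_sq _

end FiniteProduct

/-! ### Matrix Chernoff bound for random projections. -/

section MatrixChernoff

variable {n : Type*} [Fintype n] [DecidableEq n]

open NormedSpace in
-- All positive powers of `M` coincide. The exponential is therefore affine in `M`, so its average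
-- over random projections depends only on their mean.
lemma exp_smul_of_idempotent {M : Matrix n n ℝ} (hM : M * M = M) (s : ℝ) :
    exp (s • M) = 1 + (Real.exp s - 1) • M := by
  have hpow : ∀ k : ℕ, M ^ (k + 1) = M := by
    intro k
    induction k with
    | zero => simp
    | succ k ih => rw [pow_succ, ih, hM]
  have h1 : HasSum (fun k : ℕ => ((k.factorial : ℝ)⁻¹ * s ^ k) • M) (Real.exp s • M) := by
    rw [Real.exp_eq_exp_ℝ]
    exact (exp_series_hasSum_exp' (𝕂 := ℝ) s).smul_const M
  have h2 : HasSum (fun k : ℕ => if k = 0 then 1 - M else 0) (1 - M) := hasSum_ite_eq 0 (1 - M)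
  rw [exp_eq_tsum ℝ]
  have e : (fun k : ℕ => ((k.factorial : ℝ)⁻¹) • (s • M) ^ k)
      = fun k : ℕ => ((k.factorial : ℝ)⁻¹ * s ^ k) • M + if k = 0 then 1 - M else 0 := by
    funext k
    cases k with
    | zero => simp
    | succ k => rw [smul_pow, hpow, smul_smul]; simp
  simp only [e]
  rw [(h1.add h2).tsum_eq, sub_smul, one_smul]
  abel

open NormedSpace in
-- In an eigenbasis the quadratic form is an average of eigenvalues with weights `w i ^ 2`; Jensen's
-- inequality moves the exponential inside, and each weight is at most 1.
lemma exp_dotProduct_le_trace_exp {H : Matrix n n ℝ} (hH : Hᵀ = H) {v : n → ℝ}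
    (hv : v ⬝ᵥ v = 1) : Real.exp (v ⬝ᵥ (H *ᵥ v)) ≤ (exp H).trace := by
  obtain ⟨U, D, hU1, hs⟩ : ∃ (U : Matrix n n ℝ) (D : n → ℝ), U * Uᵀ = 1 ∧
      H = U * diagonal D * Uᵀ := by
    have hH' : H.IsHermitian := by rw [IsHermitian, conjTranspose_eq_transpose_of_trivial, hH]
    refine ⟨(hH'.eigenvectorUnitary : Matrix n n ℝ), hH'.eigenvalues, ?_, ?_⟩
    · have := Matrix.mem_unitaryGroup_iff.1 hH'.eigenvectorUnitary.2
      rwa [star_eq_conjTranspose, conjTranspose_eq_transpose_of_trivial] at this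
    · have := hH'.spectral_theorem
      rw [Unitary.conjStarAlgAut_apply, star_eq_conjTranspose,
        conjTranspose_eq_transpose_of_trivial] at this
      exact this
  have hU2 : Uᵀ * U = 1 := mul_eq_one_comm.1 hU1
  have hinv : U⁻¹ = Uᵀ := inv_eq_right_inv hU1
  have hUu : IsUnit U := IsUnit.of_mul_eq_one _ hU1
  have htr : (exp H).trace = ∑ i, Real.exp (D i) := by
    rw [hs, ← hinv, Matrix.exp_conj _ _ hUu, trace_mul_comm, ← mul_assoc, hinv, hU2, one_mul,
      Matrix.exp_diagonal, trace_diagonal]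
    refine Finset.sum_congr rfl fun i _ => ?_
    rw [Real.exp_eq_exp_ℝ, Pi.coe_exp]
  set w := Uᵀ *ᵥ v with hw
  have hww : ∑ i, w i ^ 2 = 1 := by
    have : w ⬝ᵥ w = 1 := by
      rw [hw, dotProduct_mulVec, ← mulVec_transpose, transpose_transpose, mulVec_mulVec, hU1,
        one_mulVec, hv]
    rw [← this]
    simp [dotProduct, sq]
  have hq : v ⬝ᵥ (H *ᵥ v) = ∑ i, w i ^ 2 * D i := by
    have e : v ⬝ᵥ (H *ᵥ v) = w ⬝ᵥ (diagonal D *ᵥ w) := by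
      conv_lhs => rw [hs]
      rw [hw, ← mulVec_mulVec, ← mulVec_mulVec, dotProduct_mulVec v, ← mulVec_transpose]
    rw [e]
    simp only [dotProduct, mulVec_diagonal]
    exact Finset.sum_congr rfl fun i _ => by ring
  rw [hq, htr]
  calc Real.exp (∑ i, w i ^ 2 * D i)
      ≤ ∑ i, w i ^ 2 * Real.exp (D i) := by
        simpa using convexOn_exp.map_sum_le (t := Finset.univ) (w := fun i => w i ^ 2)
          (p := D) (fun i _ => sq_nonneg _) hww (fun i _ => Set.mem_univ _)
    _ ≤ ∑ i, Real.exp (D i) := by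
        refine Finset.sum_le_sum fun i _ => ?_
        refine mul_le_of_le_one_left (Real.exp_pos _).le ?_
        rw [← hww]
        exact Finset.single_le_sum (f := fun i => w i ^ 2) (fun j _ => sq_nonneg _)
          (Finset.mem_univ i)

variable {ι : Type*} [Fintype ι] {p : ι → ℝ} {M : ι → Matrix n n ℝ}

open NormedSpace in
/-- The trace exponential moment of a sum of i.i.d. random projections. -/
theorem sum_prod_trace_exp_le (hp : ∀ i, 0 ≤ p i) (hp1 : ∑ i, p i = 1)
    (hs : ∀ i, (M i)ᵀ = M i) (hi : ∀ i, M i * M i = M i) {c t : ℝ} (hM : ∑ i, p i • M i = c • 1)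
    (hc : 0 ≤ 1 - c * (1 - Real.exp (-t))) (k : ℕ) :
    ∑ g : Fin k → ι, (∏ j, p (g j)) * (exp (-t • ∑ j, M (g j))).trace
      ≤ Fintype.card n * (1 - c * (1 - Real.exp (-t))) ^ k := by
  induction k with
  | zero => simp
  | succ k ih =>
    rw [sum_prod_mul_succ]
    -- Golden–Thompson splits off the exponential of one sample, which can then be averaged
    -- independently of the others.
    have hle : ∀ i (g : Fin k → ι),
        (exp (-t • ∑ j, M ((Fin.cons i g : Fin (k + 1) → ι) j))).trace
        ≤ (exp (-t • ∑ j, M (g j)) * (1 + (Real.exp (-t) - 1) • M i)).trace := by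
      intro i g
      rw [← exp_smul_of_idempotent (hi i), Fin.sum_univ_succ]
      simp only [Fin.cons_zero, Fin.cons_succ]
      rw [smul_add, add_comm]
      refine trace_exp_add_le _ _ ?_ ?_
      · rw [transpose_smul, transpose_sum]
        simp only [hs]
      · rw [transpose_smul, hs]
    have hprod : ∀ g : Fin k → ι, 0 ≤ ∏ j, p (g j) := fun g => Finset.prod_nonneg fun j _ => hp _
    calc ∑ i, p i * ∑ g : Fin k → ι, (∏ j, p (g j)) *
          (exp (-t • ∑ j, M ((Fin.cons i g : Fin (k + 1) → ι) j))).trace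
        ≤ ∑ i, p i * ∑ g : Fin k → ι, (∏ j, p (g j)) *
          (exp (-t • ∑ j, M (g j)) * (1 + (Real.exp (-t) - 1) • M i)).trace := by
          gcongr with i _ g _
          · exact hp i
          · exact hprod g
          · exact hle i g
      _ = ∑ g : Fin k → ι, (∏ j, p (g j)) *
          (exp (-t • ∑ j, M (g j)) * ∑ i, p i • (1 + (Real.exp (-t) - 1) • M i)).trace := by
          simp only [Finset.mul_sum, trace_sum, mul_smul_comm, trace_smul, smul_eq_mul]
          rw [Finset.sum_comm]
          refine Finset.sum_congr rfl fun g _ => Finset.sum_congr rfl fun i _ => by ring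
      _ = (1 - c * (1 - Real.exp (-t))) * ∑ g : Fin k → ι, (∏ j, p (g j)) *
          (exp (-t • ∑ j, M (g j))).trace := by
          -- The averaged factor is scalar, so it leaves the trace and the induction closes.
          have e : ∑ i, p i • (1 + (Real.exp (-t) - 1) • M i)
              = (1 - c * (1 - Real.exp (-t))) • (1 : Matrix n n ℝ) := by
            simp only [smul_add, Finset.sum_add_distrib, ← Finset.sum_smul, hp1]
            have : ∑ i, p i • (Real.exp (-t) - 1) • M i
                = (Real.exp (-t) - 1) • ∑ i, p i • M i := by
              rw [Finset.smul_sum]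
              exact Finset.sum_congr rfl fun i _ => smul_comm _ _ _
            rw [this, hM, smul_smul, ← add_smul]
            congr 1
            ring
          rw [e, Finset.mul_sum]
          refine Finset.sum_congr rfl fun g _ => ?_
          rw [mul_smul_comm, mul_one, trace_smul, smul_eq_mul]
          ring
      _ ≤ (1 - c * (1 - Real.exp (-t))) *
          (Fintype.card n * (1 - c * (1 - Real.exp (-t))) ^ k) := by gcongr
      _ = _ := by ring

end MatrixChernoff

/-! ### From bad events and finite samples to probabilities. -/

/-- Subadditivity is applied to a cover of the whole space rather than to complements, so no event
has to be shown measurable. -/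
lemma pairCondition_of_measureReal_le {Ω : Type*} [MeasurableSpace Ω] {μ : Measure Ω}
    [IsProbabilityMeasure μ] {m N n : ℕ} {S : Ω → Matrix (Fin m) (Fin N) ℝ} {ε δ : ℝ}
    {B : Matrix (Fin N) (Fin n) ℝ} {c : EuclideanSpace ℝ (Fin N)} (E F : Set Ω)
    (h : ∀ ω, ω ∉ E → ω ∉ F → IsGoodSketch ε B c (S ω)) (hEF : μ.real E + μ.real F ≤ δ) :
    PairCondition μ S ε δ B c := by
  have h1 : Set.univ ⊆ {ω | IsGoodSketch ε B c (S ω)} ∪ (E ∪ F) := by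
    intro ω _
    by_cases hE : ω ∈ E
    · exact Or.inr (Or.inl hE)
    by_cases hF : ω ∈ F
    · exact Or.inr (Or.inr hF)
    exact Or.inl (h ω hE hF)
  have h2 : μ.real Set.univ ≤ μ.real {ω | IsGoodSketch ε B c (S ω)} + (μ.real E + μ.real F) :=
    (measureReal_mono h1).trans ((measureReal_union_le _ _).trans
      (add_le_add_right (measureReal_union_le _ _) _))
  rw [probReal_univ] at h2
  unfold PairCondition
  rw [← ofReal_measureReal]
  exact ENNReal.ofReal_le_ofReal (by linarith)

/-- The case `r = 0` is split off because then `d = 0` and `m = 0` are possible, and the leverage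
probabilities do not sum to 1. -/
lemma pairCondition_of_isEmpty {Ω : Type*} [MeasurableSpace Ω] {μ : Measure Ω}
    [IsProbabilityMeasure μ] {m N : ℕ} {S : Ω → Matrix (Fin m) (Fin N) ℝ} {ε δ : ℝ} (hε : 0 ≤ ε)
    (hδ : 0 ≤ δ) (B : Matrix (Fin N) (Fin 0) ℝ) (c : EuclideanSpace ℝ (Fin N)) :
    PairCondition μ S ε δ B c := by
  refine pairCondition_of_measureReal_le ∅ ∅ (fun ω _ _ => ?_) (by simpa using hδ)
  refine isGoodSketch_of_bounds (κ := 1) hε one_pos ?_ ?_ (fun v => ?_) ?_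
  · ext i
    exact i.elim0
  · ext i
    exact i.elim0
  · simp [dotProduct]
  · simp only [Finset.univ_eq_empty, Finset.sum_empty]
    have : 0 ≤ c.ofLp ⬝ᵥ c.ofLp := Finset.sum_nonneg fun i _ => mul_self_nonneg _
    positivity

/-- Markov's inequality for functions of independent samples from a finite set. -/
lemma measureReal_le_sum_prod {Ω : Type*} [MeasurableSpace Ω] {μ : Measure Ω}
    [IsProbabilityMeasure μ] {m N : ℕ} {f : Fin m → Ω → Fin N} (hf : ∀ j, Measurable (f j))
    (hind : iIndepFun f μ) {p : Fin N → ℝ} (hp : ∀ i, 0 ≤ p i)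
    (hlaw : ∀ j i, μ {ω | f j ω = i} = ENNReal.ofReal (p i)) (P : (Fin m → Fin N) → Prop)
    (φ : (Fin m → Fin N) → ℝ) (h0 : ∀ g, 0 ≤ φ g) (h1 : ∀ g, P g → 1 ≤ φ g) :
    μ.real {ω | P fun j => f j ω} ≤ ∑ g : Fin m → Fin N, (∏ j, p (g j)) * φ g := by
  classical
  set F : Ω → Fin m → Fin N := fun ω j => f j ω with hF
  have hFm : Measurable F := measurable_pi_lambda _ hf
  have hfib : ∀ g : Fin m → Fin N, μ.real (F ⁻¹' {g}) = ∏ j, p (g j) := by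
    intro g
    have e : F ⁻¹' {g} = ⋂ j, f j ⁻¹' {g j} := by
      ext ω
      simp [hF, funext_iff]
    have h2 : μ (⋂ j, f j ⁻¹' {g j}) = ∏ j, μ (f j ⁻¹' {g j}) :=
      hind.meas_iInter fun j => ⟨{g j}, MeasurableSet.singleton _, rfl⟩
    rw [e, measureReal_def, h2, ENNReal.toReal_prod]
    refine Finset.prod_congr rfl fun j _ => ?_
    have h3 : f j ⁻¹' {g j} = {ω | f j ω = g j} := rfl
    rw [h3, hlaw, ENNReal.toReal_ofReal (hp _)]
  have hset : {ω | P fun j => f j ω} = F ⁻¹' ((Finset.univ.filter P : Finset _) : Set _) := by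
    ext ω
    simp [hF]
  have hsum := sum_measureReal_preimage_singleton (μ := μ) (f := F) (Finset.univ.filter P)
    (fun g _ => hFm (MeasurableSet.singleton g))
  rw [hset, ← hsum]
  have hprod : ∀ g : Fin m → Fin N, 0 ≤ ∏ j, p (g j) := fun g => Finset.prod_nonneg fun j _ => hp _
  calc ∑ g ∈ Finset.univ.filter P, μ.real (F ⁻¹' {g})
      ≤ ∑ g ∈ Finset.univ.filter P, (∏ j, p (g j)) * φ g := by
        refine Finset.sum_le_sum fun g hg => ?_
        rw [hfib]
        exact le_mul_of_one_le_right (hprod g) (h1 g (Finset.mem_filter.1 hg).2)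
    _ ≤ _ := Finset.sum_le_sum_of_subset_of_nonneg (Finset.filter_subset _ _)
        fun g _ _ => mul_nonneg (hprod g) (h0 g)

open NormedSpace in
/-- If the quadratic form of `A` is small in some direction, the trace of `exp (-t A)` is large. -/
lemma one_le_exp_mul_trace_exp {n : Type*} [Fintype n] [DecidableEq n] {A : Matrix n n ℝ}
    (hA : Aᵀ = A) {a t : ℝ} (ht : 0 ≤ t) {v : n → ℝ} (hv0 : 0 < v ⬝ᵥ v)
    (hv : v ⬝ᵥ (A *ᵥ v) ≤ a * (v ⬝ᵥ v)) : 1 ≤ Real.exp (t * a) * (exp (-t • A)).trace := by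
  set s := (√(v ⬝ᵥ v))⁻¹ with hs
  have hss : s * s * (v ⬝ᵥ v) = 1 := by
    rw [hs, ← mul_inv, Real.mul_self_sqrt hv0.le, inv_mul_cancel₀ hv0.ne']
  have hw : (s • v) ⬝ᵥ (s • v) = 1 := by
    rw [smul_dotProduct, dotProduct_smul, smul_eq_mul, smul_eq_mul, ← mul_assoc, hss]
  have h1 := exp_dotProduct_le_trace_exp (H := -t • A) (by rw [transpose_smul, hA]) hw
  have h2 : (s • v) ⬝ᵥ ((-t • A) *ᵥ (s • v)) = -t * (s * s * (v ⬝ᵥ (A *ᵥ v))) := by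
    simp only [smul_mulVec, mulVec_smul, smul_dotProduct, dotProduct_smul, smul_eq_mul]
    ring
  rw [h2] at h1
  have h3 : s * s * (v ⬝ᵥ (A *ᵥ v)) ≤ a := by
    calc _ ≤ s * s * (a * (v ⬝ᵥ v)) := mul_le_mul_of_nonneg_left hv (mul_self_nonneg _)
      _ = a * (s * s * (v ⬝ᵥ v)) := by ring
      _ = a := by rw [hss, mul_one]
  calc (1 : ℝ) = Real.exp (t * a) * Real.exp (-t * a) := by rw [← Real.exp_add]; simp
    _ ≤ Real.exp (t * a) * Real.exp (-t * (s * s * (v ⬝ᵥ (A *ᵥ v)))) := by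
        gcongr ?_ * Real.exp ?_
        exact mul_le_mul_of_nonpos_left h3 (by linarith)
    _ ≤ _ := by gcongr

/-! ### Leverage scores and the sampled Gram matrix. -/

section LeverageScores

variable {N r : ℕ} {Q : Matrix (Fin N) (Fin r) ℝ}

lemma leverageScore_nonneg (Q : Matrix (Fin N) (Fin r) ℝ) (i : Fin N) : 0 ≤ leverageScore Q i :=
  Finset.sum_nonneg fun _ _ => sq_nonneg _

lemma eq_zero_of_leverageScore_eq_zero {i : Fin N} (h : leverageScore Q i = 0) (k : Fin r) :
    Q i k = 0 := by
  have := (Finset.sum_eq_zero_iff_of_nonneg fun k _ => sq_nonneg (Q i k)).1 h k (Finset.mem_univ k)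
  exact pow_eq_zero_iff two_ne_zero |>.1 this

lemma sum_mul_of_orthonormal (hQ : Qᵀ * Q = 1) (k l : Fin r) :
    ∑ i, Q i k * Q i l = if k = l then 1 else 0 := by
  have := congrFun (congrFun hQ k) l
  rwa [mul_apply, one_apply] at this

lemma sum_leverageScore (hQ : Qᵀ * Q = 1) : ∑ i, leverageScore Q i = r := by
  unfold leverageScore
  rw [Finset.sum_comm]
  have : ∀ k : Fin r, ∑ i, Q i k ^ 2 = 1 := fun k => by
    simpa [sq] using sum_mul_of_orthonormal hQ k k
  simp [this]

lemma leverageProb_eq (hQ : Qᵀ * Q = 1) (i : Fin N) :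
    leverageProb Q i = leverageScore Q i / r := by
  rw [leverageProb, sum_leverageScore hQ]

lemma leverageProb_nonneg (Q : Matrix (Fin N) (Fin r) ℝ) (i : Fin N) : 0 ≤ leverageProb Q i :=
  div_nonneg (leverageScore_nonneg Q i) (Finset.sum_nonneg fun i _ => leverageScore_nonneg Q i)

lemma sum_leverageProb (hQ : Qᵀ * Q = 1) (hr : 0 < r) : ∑ i, leverageProb Q i = 1 := by
  have : (r : ℝ) ≠ 0 := by positivity
  simp only [leverageProb_eq hQ]
  rw [← Finset.sum_div, sum_leverageScore hQ, div_self this]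

/-- The orthogonal projection onto the span of row `i` of `Q`. -/
noncomputable def rowProj (Q : Matrix (Fin N) (Fin r) ℝ) (i : Fin N) : Matrix (Fin r) (Fin r) ℝ :=
  (leverageScore Q i)⁻¹ • vecMulVec (Q i) (Q i)

lemma transpose_rowProj (Q : Matrix (Fin N) (Fin r) ℝ) (i : Fin N) :
    (rowProj Q i)ᵀ = rowProj Q i := by
  rw [rowProj, transpose_smul, transpose_vecMulVec]

lemma dotProduct_row_self (Q : Matrix (Fin N) (Fin r) ℝ) (i : Fin N) :
    Q i ⬝ᵥ Q i = leverageScore Q i := by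
  simp [dotProduct, leverageScore, sq]

lemma rowProj_mul_self (Q : Matrix (Fin N) (Fin r) ℝ) (i : Fin N) :
    rowProj Q i * rowProj Q i = rowProj Q i := by
  rw [rowProj, smul_mul_smul_comm, vecMulVec_mul_vecMulVec, dotProduct_row_self, vecMulVec_smul,
    smul_smul]
  congr 1
  rcases eq_or_ne (leverageScore Q i) 0 with h | h
  · simp [h]
  · field_simp

lemma dotProduct_rowProj_mulVec (Q : Matrix (Fin N) (Fin r) ℝ) (i : Fin N) (v : Fin r → ℝ) :
    v ⬝ᵥ (rowProj Q i *ᵥ v) = (leverageScore Q i)⁻¹ * (Q *ᵥ v) i ^ 2 := by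
  have : (Q *ᵥ v) i = Q i ⬝ᵥ v := rfl
  rw [rowProj, smul_mulVec, dotProduct_smul, vecMulVec_mulVec, this, smul_eq_mul,
    op_smul_eq_smul, dotProduct_smul, smul_eq_mul, dotProduct_comm v, sq]

/-- The sampling probability cancels the normalization of the projection and leaves `QᵀQ / r`. Rows
of leverage zero vanish, which matches the convention `0⁻¹ = 0`. -/
lemma sum_leverageProb_smul_rowProj (hQ : Qᵀ * Q = 1) :
    ∑ i, leverageProb Q i • rowProj Q i = (r : ℝ)⁻¹ • (1 : Matrix (Fin r) (Fin r) ℝ) := by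
  ext k l
  rw [Matrix.sum_apply, Matrix.smul_apply, one_apply, ← sum_mul_of_orthonormal hQ, smul_eq_mul, Finset.mul_sum]
  refine Finset.sum_congr rfl fun i _ => ?_
  rw [leverageProb_eq hQ, rowProj, smul_smul, Matrix.smul_apply, vecMulVec_apply, smul_eq_mul]
  rcases eq_or_ne (leverageScore Q i) 0 with h | h
  · simp [eq_zero_of_leverageScore_eq_zero h]
  · field_simp

variable {Ω : Type*} [MeasurableSpace Ω] {μ : Measure Ω} [IsProbabilityMeasure μ] {m : ℕ}
  {f : Fin m → Ω → Fin N}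

open NormedSpace in
/-- Leverage score sampling preserves the Gram matrix from below with high probability. -/
theorem measureReal_rowProj_lt_le (hQ : Qᵀ * Q = 1) (hr : 0 < r) (hf : ∀ j, Measurable (f j))
    (hind : iIndepFun f μ)
    (hlaw : ∀ j i, μ {ω | f j ω = i} = ENNReal.ofReal (leverageProb Q i)) :
    μ.real {ω | ∃ v : Fin r → ℝ, ∑ j, v ⬝ᵥ (rowProj Q (f j ω) *ᵥ v) < 3 / 5 * (m / r) * (v ⬝ᵥ v)}
      ≤ r * Real.exp (-(3 / 40) * (m / r)) := by
  have hr' : (1 : ℝ) ≤ r := by exact_mod_cast hr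
  have hr0 : (0 : ℝ) < r := by positivity
  -- Chernoff parameter `t = 1/2`: since `1 - exp (-1/2) ≥ 3/8`, the exponent is at most `(3/10 -
  -- 3/8) m/r = -(3/40) m/r`.
  set a : ℝ := 3 / 5 * (m / r) with ha
  have hexp : Real.exp (-(1 / 2)) ≤ 5 / 8 := by
    rw [Real.exp_neg]
    have h := Real.quadratic_le_exp_of_nonneg (x := 1 / 2) (by norm_num)
    calc (Real.exp (1 / 2))⁻¹ ≤ (1 + 1 / 2 + (1 / 2) ^ 2 / 2)⁻¹ := by gcongr
      _ ≤ 5 / 8 := by norm_num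
  have hexp0 := Real.exp_pos (-(1 / 2))
  have hinv : (r : ℝ)⁻¹ ≤ 1 := inv_le_one_of_one_le₀ hr'
  have hinv0 : 0 < (r : ℝ)⁻¹ := by positivity
  have hρ0 : 0 ≤ 1 - (r : ℝ)⁻¹ * (1 - Real.exp (-(1 / 2))) := by
    have : (r : ℝ)⁻¹ * (1 - Real.exp (-(1 / 2))) ≤ 1 * 1 := by
      refine mul_le_mul hinv (by linarith) (by linarith) zero_le_one
    linarith
  have hρ : 1 - (r : ℝ)⁻¹ * (1 - Real.exp (-(1 / 2))) ≤ Real.exp (-(3 / 8) * (r : ℝ)⁻¹) := by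
    have h1 := Real.add_one_le_exp (-(3 / 8) * (r : ℝ)⁻¹)
    have h2 : (r : ℝ)⁻¹ * (3 / 8) ≤ (r : ℝ)⁻¹ * (1 - Real.exp (-(1 / 2))) := by
      gcongr
      linarith
    linarith
  have hsymm : ∀ g : Fin m → Fin N, (∑ j, rowProj Q (g j))ᵀ = ∑ j, rowProj Q (g j) := fun g => by
    rw [transpose_sum]
    simp only [transpose_rowProj]
  have hmark := measureReal_le_sum_prod hf hind (leverageProb_nonneg Q) hlaw
    (fun g => ∃ v : Fin r → ℝ, ∑ j, v ⬝ᵥ (rowProj Q (g j) *ᵥ v) < a * (v ⬝ᵥ v))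
    (fun g => Real.exp (1 / 2 * a) * (exp (-(1 / 2 : ℝ) • ∑ j, rowProj Q (g j))).trace)
    (fun g => by
      have hv : (Pi.single ⟨0, hr⟩ 1 : Fin r → ℝ) ⬝ᵥ Pi.single ⟨0, hr⟩ 1 = 1 := by simp
      have := exp_dotProduct_le_trace_exp (H := -(1 / 2 : ℝ) • ∑ j, rowProj Q (g j))
        (by rw [transpose_smul, hsymm]) hv
      exact mul_nonneg (Real.exp_pos _).le ((Real.exp_pos _).le.trans this))
    (fun g ⟨v, hv⟩ => by
      have hnn : 0 ≤ ∑ j, v ⬝ᵥ (rowProj Q (g j) *ᵥ v) := Finset.sum_nonneg fun j _ => by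
        rw [dotProduct_rowProj_mulVec]
        exact mul_nonneg (inv_nonneg.2 (leverageScore_nonneg _ _)) (sq_nonneg _)
      have hvv : 0 ≤ v ⬝ᵥ v := Finset.sum_nonneg fun i _ => mul_self_nonneg _
      have hv0 : 0 < v ⬝ᵥ v := by
        refine lt_of_le_of_ne hvv fun h => ?_
        rw [← h, mul_zero] at hv
        linarith
      refine one_le_exp_mul_trace_exp (hsymm g) (by norm_num) hv0 ?_
      rw [sum_mulVec, dotProduct_sum]
      exact hv.le)
  refine hmark.trans ?_
  have hch := sum_prod_trace_exp_le (leverageProb_nonneg Q) (sum_leverageProb hQ hr)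
    (transpose_rowProj Q) (rowProj_mul_self Q) (sum_leverageProb_smul_rowProj hQ) hρ0 m
  rw [Fintype.card_fin] at hch
  calc _ = Real.exp (1 / 2 * a) * ∑ g : Fin m → Fin N, (∏ j, leverageProb Q (g j)) *
        (exp (-(1 / 2 : ℝ) • ∑ j, rowProj Q (g j))).trace := by
        rw [Finset.mul_sum]
        exact Finset.sum_congr rfl fun g _ => by ring
    _ ≤ Real.exp (1 / 2 * a) * (r * Real.exp (-(3 / 8) * (r : ℝ)⁻¹) ^ m) := by
        gcongr
        refine hch.trans ?_
        gcongr
    _ = r * (Real.exp (1 / 2 * a) * Real.exp (m * (-(3 / 8) * (r : ℝ)⁻¹))) := by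
        rw [Real.exp_nat_mul]
        ring
    _ = _ := by
        rw [← Real.exp_add, ha]
        congr 2
        field_simp
        ring

end LeverageScores

/-! ### Leverage score sketches: correlation with `h` and the two sample sizes. -/

section LeverageSketch

variable {N r m : ℕ} {Q : Matrix (Fin N) (Fin r) ℝ}

/-- The importance weighted product of column `k` of `Q` with `h`. -/
noncomputable def rowCorr (Q : Matrix (Fin N) (Fin r) ℝ) (h : Fin N → ℝ) (k : Fin r) (i : Fin N) :
    ℝ :=
  Q i k * h i / leverageProb Q i

lemma eq_zero_of_leverageProb_eq_zero (hQ : Qᵀ * Q = 1) (hr : 0 < r) {i : Fin N}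
    (h : leverageProb Q i = 0) (k : Fin r) : Q i k = 0 := by
  rw [leverageProb_eq hQ, div_eq_zero_iff] at h
  exact eq_zero_of_leverageScore_eq_zero (h.resolve_right (by positivity)) k

lemma sum_leverageProb_mul_rowCorr (hQ : Qᵀ * Q = 1) (hr : 0 < r) {h : Fin N → ℝ}
    (hh : Qᵀ *ᵥ h = 0) (k : Fin r) : ∑ i, leverageProb Q i * rowCorr Q h k i = 0 := by
  have hk := congrFun hh k
  rw [Pi.zero_apply] at hk
  rw [← hk]
  simp only [mulVec, dotProduct, transpose_apply]
  refine Finset.sum_congr rfl fun i _ => ?_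
  rw [rowCorr]
  rcases eq_or_ne (leverageProb Q i) 0 with h0 | h0
  · rw [h0, eq_zero_of_leverageProb_eq_zero hQ hr h0]
    simp
  · field_simp

/-- Summed over `k`, row `i` contributes `h i ^ 2` times leverage over probability, which is `r * h
i ^ 2`. Rows of leverage zero contribute nothing, so only an inequality remains. -/
lemma sum_sum_leverageProb_mul_rowCorr_sq_le (hQ : Qᵀ * Q = 1) (hr : 0 < r) (h : Fin N → ℝ) :
    ∑ k, ∑ i, leverageProb Q i * rowCorr Q h k i ^ 2 ≤ r * (h ⬝ᵥ h) := by
  have hr0 : (r : ℝ) ≠ 0 := by positivity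
  rw [Finset.sum_comm, dotProduct, Finset.mul_sum]
  refine Finset.sum_le_sum fun i _ => ?_
  rcases eq_or_ne (leverageScore Q i) 0 with h0 | h0
  · simp only [rowCorr, eq_zero_of_leverageScore_eq_zero h0]
    simp only [zero_mul, zero_div, ne_eq, OfNat.ofNat_ne_zero, not_false_eq_true, zero_pow,
      mul_zero, Finset.sum_const_zero]
    exact mul_nonneg (by positivity) (mul_self_nonneg _)
  · refine le_of_eq ?_
    have e : ∀ k, leverageProb Q i * rowCorr Q h k i ^ 2
        = Q i k ^ 2 * (r * (h i * h i) / leverageScore Q i) := fun k => by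
      rw [rowCorr, leverageProb_eq hQ]
      field_simp
    simp only [e]
    rw [← Finset.sum_mul]
    change leverageScore Q i * _ = _
    field_simp

lemma mulVec_leverageSketch {S : Matrix (Fin m) (Fin N) ℝ} {g : Fin m → Fin N}
    (hS : ∀ j i, S j i = if g j = i then 1 / √((m : ℝ) * leverageProb Q (g j)) else 0)
    (w : Fin N → ℝ) (j : Fin m) :
    (S *ᵥ w) j = 1 / √((m : ℝ) * leverageProb Q (g j)) * w (g j) := by
  simp [mulVec, dotProduct, hS]

lemma isGoodSketch_leverage (hQ : Qᵀ * Q = 1) (hr : 0 < r) (hm : 0 < m)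
    {h : EuclideanSpace ℝ (Fin N)} (hh : Qᵀ *ᵥ h.ofLp = 0) {ε : ℝ} (hε : 0 ≤ ε)
    {S : Matrix (Fin m) (Fin N) ℝ} {g : Fin m → Fin N}
    (hS : ∀ j i, S j i = if g j = i then 1 / √((m : ℝ) * leverageProb Q (g j)) else 0)
    (h1 : ¬ ∃ v : Fin r → ℝ,
      ∑ j, v ⬝ᵥ (rowProj Q (g j) *ᵥ v) < 3 / 5 * (m / r) * (v ⬝ᵥ v))
    (h2 : ∑ k, (∑ j, rowCorr Q h.ofLp k (g j)) ^ 2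
      ≤ m ^ 2 * (2 * ε * (3 / 5) ^ 2 * (h.ofLp ⬝ᵥ h.ofLp))) :
    IsGoodSketch ε Q h S := by
  have hr0 : (0 : ℝ) < r := by positivity
  have hm0 : (0 : ℝ) < m := by positivity
  have hsq : ∀ i, 1 / √((m : ℝ) * leverageProb Q i) * (1 / √((m : ℝ) * leverageProb Q i))
      = (m * leverageProb Q i)⁻¹ := fun i => by
    rw [one_div, ← mul_inv, Real.mul_self_sqrt (mul_nonneg hm0.le (leverageProb_nonneg Q i))]
  refine isGoodSketch_of_bounds (κ := 3 / 5) hε (by norm_num) hQ hh (fun v => ?_) ?_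
  · push Not at h1
    have e : ((S * Q) *ᵥ v) ⬝ᵥ ((S * Q) *ᵥ v)
        = r / m * ∑ j, v ⬝ᵥ (rowProj Q (g j) *ᵥ v) := by
      rw [← mulVec_mulVec, dotProduct, Finset.mul_sum]
      refine Finset.sum_congr rfl fun j _ => ?_
      rw [mulVec_leverageSketch hS, dotProduct_rowProj_mulVec, mul_mul_mul_comm, hsq,
        leverageProb_eq hQ, mul_inv, inv_div]
      ring
    rw [e]
    calc 3 / 5 * (v ⬝ᵥ v) = r / m * (3 / 5 * (m / r) * (v ⬝ᵥ v)) := by field_simp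
      _ ≤ _ := by
        gcongr
        exact h1 v
  · have e : ∀ k, ((S * Q)ᵀ *ᵥ (S *ᵥ h.ofLp)) k
        = (m : ℝ)⁻¹ * ∑ j, rowCorr Q h.ofLp k (g j) := by
      intro k
      simp only [mulVec, dotProduct, transpose_apply]
      rw [Finset.mul_sum]
      refine Finset.sum_congr rfl fun j _ => ?_
      have e1 : (S * Q) j k = 1 / √((m : ℝ) * leverageProb Q (g j)) * Q (g j) k :=
        mulVec_leverageSketch hS (fun i => Q i k) j
      have e2 : ∑ i, S j i * h.ofLp i = 1 / √((m : ℝ) * leverageProb Q (g j)) * h.ofLp (g j) :=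
        mulVec_leverageSketch hS h.ofLp j
      rw [e1, e2, mul_mul_mul_comm, hsq, rowCorr, mul_inv]
      ring
    simp only [e, mul_pow, ← Finset.mul_sum]
    rw [inv_pow, inv_mul_le_iff₀ (by positivity)]
    exact h2

variable {Ω : Type*} [MeasurableSpace Ω] {μ : Measure Ω} [IsProbabilityMeasure μ]
  {f : Fin m → Ω → Fin N}

/-- Markov's inequality for the squared norm; the cross terms of independent centred samples vanish,
so the second moment is at most `m r`. -/
lemma measureReal_sum_rowCorr_sq_le (hQ : Qᵀ * Q = 1) (hr : 0 < r) (hm : 0 < m)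
    (hf : ∀ j, Measurable (f j)) (hind : iIndepFun f μ)
    (hlaw : ∀ j i, μ {ω | f j ω = i} = ENNReal.ofReal (leverageProb Q i))
    {h : Fin N → ℝ} (hh : Qᵀ *ᵥ h = 0) (hh1 : h ⬝ᵥ h = 1) {τ : ℝ} (hτ : 0 < τ) :
    μ.real {ω | ¬ ∑ k, (∑ j, rowCorr Q h k (f j ω)) ^ 2 ≤ m ^ 2 * τ} ≤ r / (m * τ) := by
  have hm0 : (0 : ℝ) < m := by positivity
  refine (measureReal_le_sum_prod hf hind (leverageProb_nonneg Q) hlaw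
    (fun g => ¬ ∑ k, (∑ j, rowCorr Q h k (g j)) ^ 2 ≤ m ^ 2 * τ)
    (fun g => (∑ k, (∑ j, rowCorr Q h k (g j)) ^ 2) / (m ^ 2 * τ))
    (fun g => by positivity) (fun g hg => ?_)).trans ?_
  · rw [one_le_div (by positivity)]
    exact (not_le.1 hg).le
  have e : ∑ g : Fin m → Fin N, (∏ j, leverageProb Q (g j)) *
      ((∑ k, (∑ j, rowCorr Q h k (g j)) ^ 2) / (m ^ 2 * τ))
      = (∑ k, m * ∑ i, leverageProb Q i * rowCorr Q h k i ^ 2) / (m ^ 2 * τ) := by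
    simp only [← sum_prod_mul_sum_sq (sum_leverageProb hQ hr) _
      (sum_leverageProb_mul_rowCorr hQ hr hh _), ← mul_div_assoc, ← Finset.sum_div, Finset.mul_sum]
    rw [Finset.sum_comm]
  rw [e, ← Finset.mul_sum]
  calc _ ≤ m * (r * (h ⬝ᵥ h)) / (m ^ 2 * τ) := by
        gcongr
        exact sum_sum_leverageProb_mul_rowCorr_sq_le hQ hr h
    _ = _ := by
        rw [hh1]
        field_simp

lemma measureReal_sum_rowCorr_sq_le_exp (hQ : Qᵀ * Q = 1) (hr : 0 < r)
    (hf : ∀ j, Measurable (f j)) (hind : iIndepFun f μ)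
    (hlaw : ∀ j i, μ {ω | f j ω = i} = ENNReal.ofReal (leverageProb Q i))
    {h : Fin N → ℝ} (hh : Qᵀ *ᵥ h = 0) {C : ℝ} (hC : 0 < C)
    (hb : ∀ k i, 0 < leverageProb Q i → |rowCorr Q h k i| ≤ C) {s : ℝ} (hs : 0 < s) :
    μ.real {ω | ¬ ∑ k, (∑ j, rowCorr Q h k (f j ω)) ^ 2 ≤ m ^ 2 * (r * s ^ 2)}
      ≤ 2 * r * Real.exp (-(m * s ^ 2 / (2 * C ^ 2))) := by
  -- Minimises the Hoeffding exponent `-t m s + m t² C² / 2`.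
  set t := s / C ^ 2 with ht
  have ht0 : 0 < t := by positivity
  refine (measureReal_le_sum_prod hf hind (leverageProb_nonneg Q) hlaw
    (fun g => ¬ ∑ k, (∑ j, rowCorr Q h k (g j)) ^ 2 ≤ m ^ 2 * (r * s ^ 2))
    (fun g => ∑ k, Real.exp (-(t * (m * s))) * (Real.exp (∑ j, t * rowCorr Q h k (g j))
      + Real.exp (∑ j, -t * rowCorr Q h k (g j)))) (fun g => by positivity) (fun g hg => ?_)).trans ?_
  -- If the sum over `r` columns is too large, some column exceeds its equal share; the sum over `k`
  -- and over both signs is the union bound.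
  · obtain ⟨k, hk⟩ : ∃ k, (m * s) ^ 2 < (∑ j, rowCorr Q h k (g j)) ^ 2 := by
      by_contra! hcon
      refine hg ((Finset.sum_le_sum fun k _ => hcon k).trans_eq ?_)
      rw [Finset.sum_const, Finset.card_univ, Fintype.card_fin, nsmul_eq_mul]
      ring
    have habs : m * s ≤ |∑ j, rowCorr Q h k (g j)| := by
      have := sq_lt_sq.1 hk
      rw [abs_of_nonneg (by positivity : (0 : ℝ) ≤ m * s)] at this
      exact this.le
    refine le_trans ?_ (Finset.single_le_sum (f := fun k => Real.exp (-(t * (m * s))) *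
      (Real.exp (∑ j, t * rowCorr Q h k (g j)) + Real.exp (∑ j, -t * rowCorr Q h k (g j))))
      (fun k _ => by positivity) (Finset.mem_univ k))
    simp only [← Finset.mul_sum]
    have h1 : Real.exp (t * (m * s)) ≤ Real.exp (t * ∑ j, rowCorr Q h k (g j))
        + Real.exp (-t * ∑ j, rowCorr Q h k (g j)) := by
      rcases le_abs'.1 habs with hle | hle
      · have : Real.exp (t * (m * s)) ≤ Real.exp (-t * ∑ j, rowCorr Q h k (g j)) := by
          refine Real.exp_le_exp.2 ?_
          rw [neg_mul_comm]
          gcongr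
          linarith
        have h0 := Real.exp_pos (t * ∑ j, rowCorr Q h k (g j))
        linarith
      · have : Real.exp (t * (m * s)) ≤ Real.exp (t * ∑ j, rowCorr Q h k (g j)) := by gcongr
        have h0 := Real.exp_pos (-t * ∑ j, rowCorr Q h k (g j))
        linarith
    calc (1 : ℝ) = Real.exp (-(t * (m * s))) * Real.exp (t * (m * s)) := by
          rw [← Real.exp_add]; simp
      _ ≤ _ := by gcongr
  have hmgf : ∀ (u : ℝ) k, ∑ g : Fin m → Fin N, (∏ j, leverageProb Q (g j)) *
      Real.exp (∑ j, u * rowCorr Q h k (g j)) ≤ Real.exp ((u * C) ^ 2 / 2) ^ m := by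
    intro u k
    rw [sum_prod_mul_exp_sum (fun i => u * rowCorr Q h k i)]
    refine pow_le_pow_left₀ (Finset.sum_nonneg fun i _ =>
      mul_nonneg (leverageProb_nonneg Q i) (Real.exp_pos _).le) ?_ m
    exact sum_mul_exp_le (leverageProb_nonneg Q) (sum_leverageProb hQ hr)
      (sum_leverageProb_mul_rowCorr hQ hr hh k) hC (hb k) u
  calc _ = ∑ k, Real.exp (-(t * (m * s))) *
        ((∑ g : Fin m → Fin N, (∏ j, leverageProb Q (g j)) *
          Real.exp (∑ j, t * rowCorr Q h k (g j)))
        + ∑ g : Fin m → Fin N, (∏ j, leverageProb Q (g j)) *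
          Real.exp (∑ j, -t * rowCorr Q h k (g j))) := by
        simp only [Finset.mul_sum, ← Finset.sum_add_distrib]
        rw [Finset.sum_comm]
        exact Finset.sum_congr rfl fun k _ => Finset.sum_congr rfl fun g _ => by ring
    _ ≤ ∑ k : Fin r, Real.exp (-(t * (m * s))) *
        (Real.exp ((t * C) ^ 2 / 2) ^ m + Real.exp ((-t * C) ^ 2 / 2) ^ m) := by
        gcongr
        · exact hmgf t _
        · exact hmgf (-t) _
    _ = 2 * r * (Real.exp (-(t * (m * s))) * Real.exp (m * ((t * C) ^ 2 / 2))) := by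
        rw [Finset.sum_const, Finset.card_univ, Fintype.card_fin, nsmul_eq_mul, Real.exp_nat_mul,
          neg_mul, neg_sq]
        ring
    _ = _ := by
        rw [← Real.exp_add, ht]
        congr 2
        field_simp
        ring

lemma card_mul_exp_neg_log {d L : ℕ} (hd : 0 < d) (hL : 1 ≤ L) {δ : ℝ} (hδ : 0 < δ) :
    Real.exp (-Real.log (4 * d * L / δ)) = δ / (4 * d * L) := by
  have : (0 : ℝ) < L := by positivity
  rw [Real.exp_neg, Real.exp_log (by positivity), inv_div]

lemma one_le_log_four_mul {d L : ℕ} (hd : 0 < d) (hL : 1 ≤ L) {δ : ℝ} (hδ : 0 < δ) (hδ1 : δ ≤ 1) :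
    1 ≤ Real.log (4 * d * L / δ) := by
  have hd' : (1 : ℝ) ≤ d := by exact_mod_cast hd
  have hL' : (1 : ℝ) ≤ L := by exact_mod_cast hL
  rw [Real.le_log_iff_exp_le (by positivity), le_div_iff₀ hδ]
  have := Real.exp_one_lt_d9
  have h1 : (1 : ℝ) ≤ d * L := one_le_mul_of_one_le_of_one_le hd' hL'
  nlinarith [mul_le_mul_of_nonneg_left hδ1 (Real.exp_pos 1).le]

/-- As `35 * 3/40 > 2`, the exponential is at most `(δ/(4dL))²`, and `d` times this is `δ/L *
δ/(16dL)`, a 1/32 share of the failure budget. -/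
lemma mul_exp_neg_le {d r m L : ℕ} (hr : 0 < r) (hrd : r ≤ d) (hL : 1 ≤ L) {δ : ℝ} (hδ : 0 < δ)
    (hδ1 : δ < 1 / 2) (hm : 35 * d * Real.log (4 * d * L / δ) ≤ m) :
    r * Real.exp (-(3 / 40) * (m / r)) ≤ δ / L / 32 := by
  have hd : 0 < d := hr.trans_le hrd
  have hr0 : (0 : ℝ) < r := by positivity
  have hd1 : (1 : ℝ) ≤ d := by exact_mod_cast hd
  have hL1 : (1 : ℝ) ≤ L := by exact_mod_cast hL
  have hrd' : (r : ℝ) ≤ d := by exact_mod_cast hrd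
  have hlog := one_le_log_four_mul hd hL hδ (by linarith)
  set ℓ := Real.log (4 * d * L / δ) with hℓ
  have h1 : 35 * ℓ ≤ m / r := by
    rw [le_div_iff₀ hr0]
    calc 35 * ℓ * r ≤ 35 * ℓ * d := by gcongr
      _ = 35 * d * ℓ := by ring
      _ ≤ m := hm
  calc r * Real.exp (-(3 / 40) * (m / r)) ≤ d * Real.exp (-ℓ + -ℓ) := by
        gcongr
        linarith
    _ = d * (δ / (4 * d * L)) ^ 2 := by
        rw [Real.exp_add, hℓ, card_mul_exp_neg_log hd hL hδ, sq]
    _ = δ / L * (δ / (16 * (d * L))) := by field_simp; ring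
    _ ≤ δ / L * ((1 / 2) / (16 * 1)) := by
        gcongr
        exact one_le_mul_of_one_le_of_one_le hd1 hL1
    _ = _ := by ring

variable {d L : ℕ} {A : Matrix (Fin N) (Fin d) ℝ} {b b' : EuclideanSpace ℝ (Fin N)}
  {S : Ω → Matrix (Fin m) (Fin N) ℝ} {ε δ : ℝ}

/-- Common core of both leverage score claims: the Gram event uses 1/32 of the budget, and the
correlation event may use the rest. -/
lemma pairCondition_leverage_of_measureReal_le (hA : IsOrth A Q) (hr : 0 < r) (hL : 1 ≤ L)
    (hε : 0 < ε) (hδ : 0 < δ) (hδ1 : δ < 1 / 2) (hf : ∀ j, Measurable (f j))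
    (hind : iIndepFun f μ)
    (hlaw : ∀ j i, μ {ω | f j ω = i} = ENNReal.ofReal (leverageProb Q i))
    (hS : ∀ ω j i, S ω j i =
      if f j ω = i then 1 / √((m : ℝ) * leverageProb Q (f j ω)) else 0)
    (hm : 35 * d * Real.log (4 * d * L / δ) ≤ m)
    (hF : (diffVec Q b b').ofLp ⬝ᵥ (diffVec Q b b').ofLp = 1 →
      μ.real {ω | ¬ ∑ k, (∑ j, rowCorr Q (diffVec Q b b').ofLp k (f j ω)) ^ 2
        ≤ m ^ 2 * (2 * ε * (3 / 5) ^ 2)} ≤ 31 / 32 * (δ / L)) :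
    PairCondition μ S ε (δ / L) Q (diffVec Q b b') := by
  have hrd := rank_le_of_isOrth hA
  have hd : 0 < d := hr.trans_le hrd
  have hlog := one_le_log_four_mul hd hL hδ (by linarith)
  have hm0 : 0 < m := by
    have : (0 : ℝ) < m := lt_of_lt_of_le (by positivity) hm
    exact_mod_cast this
  have hL0 : (0 : ℝ) < L := by exact_mod_cast hL
  have hE := (measureReal_rowProj_lt_le hA.1 hr hf hind hlaw).trans
    (mul_exp_neg_le hr hrd hL hδ hδ1 hm)
  have hperp := transpose_mulVec_diffVec Q b b'
  rcases diffVec_dotProduct_self Q b b' with h0 | h1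
  · refine pairCondition_of_measureReal_le _ ∅ (fun ω hω _ =>
      isGoodSketch_leverage hA.1 hr hm0 hperp hε.le (hS ω) hω ?_) ?_
    · simp [h0, rowCorr]
    · rw [measureReal_empty, add_zero]
      have : 0 < δ / L := by positivity
      exact hE.trans (by linarith)
  · refine pairCondition_of_measureReal_le _ _ (fun ω hω hω' =>
      isGoodSketch_leverage hA.1 hr hm0 hperp hε.le (hS ω) hω ?_)
      ((add_le_add hE (hF h1)).trans_eq (by ring))
    rw [h1, mul_one]
    exact not_not.1 hω'

theorem pairCondition_leverage (hA : IsOrth A Q) (hL : 1 ≤ L) (hε : 0 < ε) (hδ : 0 < δ)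
    (hδ1 : δ < 1 / 2) (hS : IsLeverageScoreSketch μ Q S)
    (hm : max (35 * d * Real.log (4 * d * L / δ)) (2 * d * L / (ε * δ)) ≤ (m : ℝ)) :
    PairCondition μ S ε (δ / L) Q (diffVec Q b b') := by
  rcases Nat.eq_zero_or_pos r with rfl | hr
  · exact pairCondition_of_isEmpty hε.le (by positivity) Q _
  obtain ⟨f, hf, hind, hlaw, hS⟩ := hS
  refine pairCondition_leverage_of_measureReal_le hA hr hL hε hδ hδ1 hf hind hlaw hS
    ((le_max_left _ _).trans hm) fun h1 => ?_
  have hrd := rank_le_of_isOrth hA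
  have hd : 0 < d := hr.trans_le hrd
  have hd0 : (0 : ℝ) < d := by exact_mod_cast hd
  have hL0 : (0 : ℝ) < L := by exact_mod_cast hL
  have hm2 := (le_max_right _ _).trans hm
  have hm0' : (0 : ℝ) < m := lt_of_lt_of_le (by positivity) hm2
  refine (measureReal_sum_rowCorr_sq_le hA.1 hr (by exact_mod_cast hm0') hf hind hlaw
    (transpose_mulVec_diffVec Q b b') h1 (by positivity)).trans ?_
  rw [div_le_iff₀ (by positivity)]
  have hrd' : (r : ℝ) ≤ d := by exact_mod_cast hrd
  rw [div_le_iff₀ (by positivity)] at hm2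
  refine hrd'.trans ?_
  -- Here `279/400 ≥ 1/2` is all that is needed, since `m ε δ ≥ 2 d L`.
  have e : 31 / 32 * (δ / L) * (m * (2 * ε * (3 / 5) ^ 2)) = 279 / 400 * (m * (ε * δ)) / L := by
    field_simp
    ring
  rw [e, le_div_iff₀ hL0]
  have := mul_pos hd0 hL0
  linarith

theorem pairCondition_leverage_of_bounded (hA : IsOrth A Q) (hL : 1 ≤ L) (hε : 0 < ε) (hδ : 0 < δ)
    (hδ1 : δ < 1 / 2) (hS : IsLeverageScoreSketch μ Q S) {C : ℝ} (hC : 0 < C)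
    (hb : ∀ (i : Fin r) (j : Fin N), 0 < leverageScore Q j →
      d * |Q j i * diffVec Q b b' j| / leverageScore Q j ≤ C)
    (hm : max 35 (4 * C ^ 2 / ε) * d * Real.log (4 * d * L / δ) ≤ (m : ℝ)) :
    PairCondition μ S ε (δ / L) Q (diffVec Q b b') := by
  rcases Nat.eq_zero_or_pos r with rfl | hr
  · exact pairCondition_of_isEmpty hε.le (by positivity) Q _
  obtain ⟨f, hf, hind, hlaw, hS⟩ := hS
  have hrd := rank_le_of_isOrth hA
  have hd : 0 < d := hr.trans_le hrd
  have hd0 : (0 : ℝ) < d := by exact_mod_cast hd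
  have hr0 : (0 : ℝ) < r := by exact_mod_cast hr
  have hL0 : (0 : ℝ) < L := by exact_mod_cast hL
  have hrd' : (r : ℝ) ≤ d := by exact_mod_cast hrd
  have hlog := one_le_log_four_mul hd hL hδ (by linarith)
  refine pairCondition_leverage_of_measureReal_le hA hr hL hε hδ hδ1 hf hind hlaw hS
    (le_trans (by gcongr; exact le_max_left _ _) hm) fun h1 => ?_
  have hm2 : 4 * C ^ 2 / ε * d * Real.log (4 * d * L / δ) ≤ m :=
    le_trans (by gcongr; exact le_max_right _ _) hm
  set ℓ := Real.log (4 * d * L / δ) with hℓ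
  -- An equal share of the tolerance `2 ε κ²`, `κ = 3/5`, for each of the `r` columns.
  set s := √(2 * ε * (3 / 5) ^ 2 / r) with hs
  have hs2 : s ^ 2 = 2 * ε * (3 / 5) ^ 2 / r := Real.sq_sqrt (by positivity)
  have hrs : 2 * ε * (3 / 5) ^ 2 = r * s ^ 2 := by
    rw [hs2]
    field_simp
  rw [hrs]
  refine (measureReal_sum_rowCorr_sq_le_exp hA.1 hr hf hind hlaw
    (transpose_mulVec_diffVec Q b b') hC (fun k i hi => ?_) (by positivity)).trans ?_
  · have hp : 0 < leverageScore Q i := by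
      rw [leverageProb_eq hA.1] at hi
      exact (div_pos_iff_of_pos_right hr0).1 hi
    refine le_trans ?_ (hb k i hp)
    rw [rowCorr, abs_div, abs_of_pos hi, leverageProb_eq hA.1, div_div_eq_mul_div, mul_comm]
    gcongr
  have h2 : ℓ ≤ m * s ^ 2 / (2 * C ^ 2) := by
    rw [hs2, le_div_iff₀ (by positivity)]
    have h3 : 4 * C ^ 2 * r * ℓ ≤ m * ε := by
      calc 4 * C ^ 2 * r * ℓ ≤ 4 * C ^ 2 * d * ℓ := by gcongr
        _ = 4 * C ^ 2 / ε * d * ℓ * ε := by field_simp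
        _ ≤ m * ε := by gcongr
    have e : m * (2 * ε * (3 / 5) ^ 2 / r) = 18 / 25 * (m * ε / r) := by ring
    rw [e]
    have h4 : 4 * C ^ 2 * ℓ ≤ m * ε / r := by
      rw [le_div_iff₀ hr0]
      linarith
    have : 0 ≤ C ^ 2 * ℓ := by positivity
    linarith
  calc 2 * r * Real.exp (-(m * s ^ 2 / (2 * C ^ 2))) ≤ 2 * d * Real.exp (-ℓ) := by gcongr
    _ = δ / L / 2 := by
        rw [hℓ, card_mul_exp_neg_log hd hL hδ]
        field_simp
        ring
    _ ≤ _ := by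
        have : 0 < δ / L := by positivity
        linarith

end LeverageSketch

/-! ### Sub-Gaussian and sub-exponential variables; Bernstein's inequality. -/

section SubGaussian

open Real in
-- With `x = t X` and `X` centred, the linear term integrates to zero, leaving the exponential of a
-- square, which the sub-Gaussian norm controls.
lemma exp_le_add_exp_sq (x : ℝ) : exp x ≤ x + exp (x ^ 2) := by
  have h1 := add_one_le_exp (x ^ 2)
  rcases le_or_gt |x| 1 with h | h
  · have := (abs_le.1 (abs_exp_sub_one_sub_id_le h)).2
    linarith
  · rcases lt_abs.1 h with h | h
    · have : exp x ≤ exp (x ^ 2) := exp_le_exp.2 (by nlinarith)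
      linarith
    · have : exp x ≤ 1 := exp_le_one_iff.2 (by linarith)
      nlinarith

lemma exp_le_one_add_add_sq_mul_exp_abs (x : ℝ) :
    Real.exp x ≤ 1 + x + x ^ 2 * Real.exp |x| := by
  have h := Complex.norm_exp_sub_sum_le_norm_mul_exp (x : ℂ) 2
  have e : Complex.exp x - ∑ m ∈ Finset.range 2, (x : ℂ) ^ m / m.factorial
      = ((Real.exp x - (1 + x) : ℝ) : ℂ) := by
    simp [Finset.sum_range_succ]
  rw [e, Complex.norm_real, Complex.norm_real, Real.norm_eq_abs, Real.norm_eq_abs, sq_abs] at h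
  linarith [(abs_le.1 h).2]

variable {Ω : Type*} [MeasurableSpace Ω] {μ : Measure Ω}

lemma integrable_and_integral_le_of_lintegral_le {f : Ω → ℝ} (hf : Measurable f)
    (h0 : ∀ ω, 0 ≤ f ω) {C : ℝ} (hC : 0 ≤ C)
    (h : ∫⁻ ω, ENNReal.ofReal (f ω) ∂μ ≤ ENNReal.ofReal C) :
    Integrable f μ ∧ ∫ ω, f ω ∂μ ≤ C := by
  refine ⟨⟨hf.aestronglyMeasurable, ?_⟩, ?_⟩
  · rw [hasFiniteIntegral_iff_ofReal (Filter.Eventually.of_forall h0)]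
    exact h.trans_lt ENNReal.ofReal_lt_top
  · rw [integral_eq_lintegral_of_nonneg_ae (Filter.Eventually.of_forall h0)
      hf.aestronglyMeasurable]
    exact ENNReal.toReal_le_of_le_ofReal hC h

variable [IsProbabilityMeasure μ]

/-- A centred random variable with `E exp (X² / a²) ≤ 2` has a sub-Gaussian moment generating
function. -/
theorem hasSubgaussianMGF_of_exp_sq {X : Ω → ℝ} (hX : Measurable X) (h0 : ∫ ω, X ω ∂μ = 0)
    {a : ℝ} (ha : 0 < a) (hint : Integrable (fun ω => Real.exp (X ω ^ 2 / a ^ 2)) μ)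
    (hle : ∫ ω, Real.exp (X ω ^ 2 / a ^ 2) ∂μ ≤ 2) {c : NNReal} (hc : 2 * a ^ 2 ≤ c) :
    HasSubgaussianMGF X c μ := by
  have hXint : Integrable X μ := by
    refine Integrable.mono' (hint.const_mul a) hX.aestronglyMeasurable
      (Filter.Eventually.of_forall fun ω => ?_)
    have h1 := Real.add_one_le_exp (X ω ^ 2 / a ^ 2)
    have h2 : |X ω| / a ≤ (|X ω| / a) ^ 2 + 1 := by nlinarith [sq_nonneg (|X ω| / a - 1)]
    rw [div_pow, sq_abs] at h2
    rw [Real.norm_eq_abs]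
    calc |X ω| = a * (|X ω| / a) := by field_simp
      _ ≤ _ := by
        gcongr
        linarith
  have hpt : ∀ t ω, Real.exp (t * X ω)
      ≤ Real.exp (t ^ 2 * a ^ 2 / 2) * (1 + 1 / 2 * (Real.exp (X ω ^ 2 / a ^ 2) - 1)) := by
    intro t ω
    have hy := Real.add_one_le_exp (X ω ^ 2 / a ^ 2 / 2)
    have hyy : Real.exp (X ω ^ 2 / a ^ 2) = Real.exp (X ω ^ 2 / a ^ 2 / 2) ^ 2 := by
      rw [← Real.exp_nat_mul]
      congr 1
      push_cast
      ring
    have h1 : Real.exp (X ω ^ 2 / a ^ 2 / 2) ≤ 1 + 1 / 2 * (Real.exp (X ω ^ 2 / a ^ 2) - 1) := by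
      rw [hyy]
      nlinarith [sq_nonneg (Real.exp (X ω ^ 2 / a ^ 2 / 2) - 1)]
    have h2 : t * X ω ≤ t ^ 2 * a ^ 2 / 2 + X ω ^ 2 / a ^ 2 / 2 := by
      have e : t * X ω = (t * a) * (X ω / a) := by field_simp
      rw [e, ← mul_pow, ← div_pow]
      nlinarith [sq_nonneg (t * a - X ω / a)]
    calc Real.exp (t * X ω) ≤ Real.exp (t ^ 2 * a ^ 2 / 2 + X ω ^ 2 / a ^ 2 / 2) :=
          Real.exp_le_exp.2 h2
      _ = Real.exp (t ^ 2 * a ^ 2 / 2) * Real.exp (X ω ^ 2 / a ^ 2 / 2) := Real.exp_add _ _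
      _ ≤ _ := by gcongr
  have hbint : ∀ q : ℝ, Integrable (fun ω => 1 + q * (Real.exp (X ω ^ 2 / a ^ 2) - 1)) μ :=
    fun q => (integrable_const 1).add ((hint.sub (integrable_const 1)).const_mul q)
  have hbval : ∀ q : ℝ, 0 ≤ q →
      ∫ ω, (1 + q * (Real.exp (X ω ^ 2 / a ^ 2) - 1)) ∂μ ≤ 1 + q := by
    intro q hq
    have hs : Integrable (fun ω => Real.exp (X ω ^ 2 / a ^ 2) - 1) μ :=
      hint.sub (integrable_const 1)
    rw [integral_add (integrable_const 1) (hs.const_mul q), integral_const_mul, integral_sub hint (integrable_const 1)]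
    simp only [integral_const, probReal_univ, smul_eq_mul, mul_one]
    nlinarith
  have hexpint : ∀ t, Integrable (fun ω => Real.exp (t * X ω)) μ := by
    intro t
    refine Integrable.mono' ((hbint (1 / 2)).const_mul (Real.exp (t ^ 2 * a ^ 2 / 2)))
      (by fun_prop) (Filter.Eventually.of_forall fun ω => ?_)
    rw [Real.norm_of_nonneg (Real.exp_pos _).le]
    exact hpt t ω
  refine ⟨hexpint, fun t => ?_⟩
  have hct : t ^ 2 * a ^ 2 ≤ c * t ^ 2 / 2 := by nlinarith [sq_nonneg t]
  refine le_trans ?_ (Real.exp_le_exp.2 hct)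
  rw [mgf]
  -- For small `t`, centring removes the linear term and convexity interpolates the exponential
  -- moment. For large `t`, the bound `hpt` suffices without centring, since its constant `3/2` is
  -- below `exp (t² a² / 2)`.
  rcases le_or_gt (t ^ 2 * a ^ 2) 1 with hq | hq
  · have hpt2 : ∀ ω, Real.exp (t * X ω)
        ≤ t * X ω + (1 + t ^ 2 * a ^ 2 * (Real.exp (X ω ^ 2 / a ^ 2) - 1)) := by
      intro ω
      refine (exp_le_add_exp_sq _).trans (add_le_add_right ?_ _)
      have hcv := convexOn_exp.2 (Set.mem_univ (X ω ^ 2 / a ^ 2)) (Set.mem_univ 0)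
        (show 0 ≤ t ^ 2 * a ^ 2 by positivity) (show 0 ≤ 1 - t ^ 2 * a ^ 2 by linarith) (by ring)
      have e2 : (t ^ 2 * a ^ 2) • (X ω ^ 2 / a ^ 2) + (1 - t ^ 2 * a ^ 2) • (0 : ℝ)
          = (t * X ω) ^ 2 := by
        simp only [smul_eq_mul]
        field_simp
        ring
      rw [e2] at hcv
      refine hcv.trans_eq ?_
      simp only [smul_eq_mul, Real.exp_zero]
      ring
    calc ∫ ω, Real.exp (t * X ω) ∂μ
        ≤ ∫ ω, (t * X ω + (1 + t ^ 2 * a ^ 2 * (Real.exp (X ω ^ 2 / a ^ 2) - 1))) ∂μ :=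
          integral_mono (hexpint t) ((hXint.const_mul t).add (hbint _)) hpt2
      _ ≤ 1 + t ^ 2 * a ^ 2 := by
          rw [integral_add (hXint.const_mul t) (hbint _), integral_const_mul, h0, mul_zero,
            zero_add]
          exact hbval _ (by positivity)
      _ ≤ Real.exp (t ^ 2 * a ^ 2) := by
          rw [add_comm]
          exact Real.add_one_le_exp _
  · calc ∫ ω, Real.exp (t * X ω) ∂μ
        ≤ ∫ ω, Real.exp (t ^ 2 * a ^ 2 / 2)
            * (1 + 1 / 2 * (Real.exp (X ω ^ 2 / a ^ 2) - 1)) ∂μ :=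
          integral_mono (hexpint t) ((hbint _).const_mul _) (hpt t)
      _ ≤ Real.exp (t ^ 2 * a ^ 2 / 2) * (1 + 1 / 2) := by
          rw [integral_const_mul]
          gcongr
          exact hbval _ (by norm_num)
      _ ≤ Real.exp (t ^ 2 * a ^ 2 / 2) * Real.exp (t ^ 2 * a ^ 2 / 2) := by
          gcongr
          have := Real.add_one_le_exp (t ^ 2 * a ^ 2 / 2)
          linarith
      _ = _ := by rw [← Real.exp_add]; ring_nf

lemma lintegral_exp_sq_gaussianReal_le :
    ∫⁻ x, ENNReal.ofReal (Real.exp (x ^ 2 / 4)) ∂(gaussianReal 0 1) ≤ 2 := by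
  have hb : (0 : ℝ) < 1 / 4 := by norm_num
  rw [gaussianReal_of_var_ne_zero _ one_ne_zero,
    lintegral_withDensity_eq_lintegral_mul _ (measurable_gaussianPDF _ _) (by fun_prop)]
  have e : ∀ x : ℝ, (gaussianPDF 0 1 * fun x => ENNReal.ofReal (Real.exp (x ^ 2 / 4))) x
      = ENNReal.ofReal ((√(2 * Real.pi))⁻¹ * Real.exp (-(1 / 4) * x ^ 2)) := by
    intro x
    rw [Pi.mul_apply, gaussianPDF, ← ENNReal.ofReal_mul (gaussianPDFReal_nonneg _ _ _),
      gaussianPDFReal, mul_assoc, ← Real.exp_add]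
    simp only [NNReal.coe_one, mul_one, sub_zero]
    congr 3
    ring
  simp only [e]
  rw [← ofReal_integral_eq_lintegral_ofReal ((integrable_exp_neg_mul_sq hb).const_mul _)
    (Filter.Eventually.of_forall fun x => by positivity), integral_const_mul, integral_gaussian,
    ← ENNReal.ofReal_ofNat 2]
  refine ENNReal.ofReal_le_ofReal ?_
  rw [← Real.sqrt_inv, ← Real.sqrt_mul (by positivity)]
  refine Real.sqrt_le_iff.2 ⟨by norm_num, ?_⟩
  have := Real.pi_pos
  field_simp
  norm_num

/-- Gaussian linearization: `exp (Z²/(4c))` is the mean of `exp (s Z x)` over a standard Gaussian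
`x` with `s² = 1/(2c)`. After exchanging the integrals the bound on the moment generating function
of `Z` leaves the mean of `exp (x²/4)`, which is `√2`. -/
lemma lintegral_exp_sq_le {Z : Ω → ℝ} (hZ : Measurable Z) {c : NNReal} (hc : 0 < c)
    (h : HasSubgaussianMGF Z c μ) :
    ∫⁻ ω, ENNReal.ofReal (Real.exp (Z ω ^ 2 / (4 * c))) ∂μ ≤ 2 := by
  have hc' : (0 : ℝ) < c := hc
  set s := √(1 / (2 * (c : ℝ))) with hs
  have hs2 : s ^ 2 = 1 / (2 * (c : ℝ)) := Real.sq_sqrt (by positivity)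
  have h1 : ∀ ω, ENNReal.ofReal (Real.exp (Z ω ^ 2 / (4 * c)))
      = ∫⁻ x, ENNReal.ofReal (Real.exp (s * Z ω * x)) ∂(gaussianReal 0 1) := by
    intro ω
    rw [← ofReal_integral_eq_lintegral_ofReal (integrable_exp_mul_gaussianReal _)
      (Filter.Eventually.of_forall fun x => (Real.exp_pos _).le)]
    have := congrFun (mgf_fun_id_gaussianReal (μ := 0) (v := 1)) (s * Z ω)
    rw [mgf] at this
    rw [this, mul_pow, hs2]
    simp only [NNReal.coe_one]
    congr 2
    field_simp
    ring
  simp only [h1]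
  rw [lintegral_lintegral_swap (by fun_prop)]
  refine (lintegral_mono fun x => ?_).trans lintegral_exp_sq_gaussianReal_le
  have e : ∀ ω, s * Z ω * x = (s * x) * Z ω := fun ω => by ring
  simp only [e]
  rw [← ofReal_integral_eq_lintegral_ofReal (h.integrable_exp_mul _)
    (Filter.Eventually.of_forall fun x => (Real.exp_pos _).le)]
  refine ENNReal.ofReal_le_ofReal ((h.mgf_le (s * x)).trans (Real.exp_le_exp.2 (le_of_eq ?_)))
  rw [mul_pow, hs2]
  field_simp
  ring

/-- A Bernstein bound for the moment generating function of a centred sub-exponential variable. -/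
theorem integral_exp_mul_le {Y : Ω → ℝ} (hY : Measurable Y) (h0 : ∫ ω, Y ω ∂μ = 0) {β : ℝ}
    (hβ : 0 < β) (hint : Integrable (fun ω => Real.exp (|Y ω| / β)) μ)
    (hle : ∫ ω, Real.exp (|Y ω| / β) ∂μ ≤ 3) {θ : ℝ} (hθ : |θ| * β ≤ 1 / 2) :
    Integrable (fun ω => Real.exp (θ * Y ω)) μ ∧
      ∫ ω, Real.exp (θ * Y ω) ∂μ ≤ Real.exp (24 * (θ * β) ^ 2) := by
  have hYint : Integrable Y μ := by
    refine Integrable.mono' (hint.const_mul β) hY.aestronglyMeasurable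
      (Filter.Eventually.of_forall fun ω => ?_)
    have h1 := Real.add_one_le_exp (|Y ω| / β)
    rw [Real.norm_eq_abs]
    calc |Y ω| = β * (|Y ω| / β) := by field_simp
      _ ≤ _ := by
        gcongr
        linarith
  have hpt : ∀ ω, Real.exp (θ * Y ω)
      ≤ 1 + θ * Y ω + 8 * (θ * β) ^ 2 * Real.exp (|Y ω| / β) := by
    intro ω
    refine (exp_le_one_add_add_sq_mul_exp_abs _).trans (add_le_add_right ?_ _)
    set u := |Y ω| / β with hu
    have hu0 : 0 ≤ u := by positivity
    have hYu : |Y ω| = β * u := by rw [hu]; field_simp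
    have e1 : (θ * Y ω) ^ 2 = (θ * β) ^ 2 * u ^ 2 := by
      rw [mul_pow, ← sq_abs (Y ω), hYu]
      ring
    have e2 : |θ * Y ω| ≤ u / 2 := by
      rw [abs_mul, hYu]
      nlinarith
    -- Half of the exponential moment absorbs the square and the other half the remainder, as `|θ| β
    -- ≤ 1/2`. Then `8 * 3 = 24`.
    have e3 : u ^ 2 ≤ 8 * Real.exp (u / 2) := by
      have := Real.quadratic_le_exp_of_nonneg (x := u / 2) (by positivity)
      nlinarith
    have e4 : Real.exp u = Real.exp (u / 2) * Real.exp (u / 2) := by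
      rw [← Real.exp_add, add_halves]
    calc (θ * Y ω) ^ 2 * Real.exp |θ * Y ω|
        ≤ (θ * β) ^ 2 * (8 * Real.exp (u / 2)) * Real.exp (u / 2) := by
          rw [e1]
          gcongr
      _ = _ := by rw [e4]; ring
  have hbint : Integrable (fun ω => 1 + θ * Y ω + 8 * (θ * β) ^ 2 * Real.exp (|Y ω| / β)) μ :=
    ((integrable_const 1).add (hYint.const_mul θ)).add (hint.const_mul _)
  have hexpint : Integrable (fun ω => Real.exp (θ * Y ω)) μ := by
    refine Integrable.mono' hbint (by fun_prop) (Filter.Eventually.of_forall fun ω => ?_)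
    rw [Real.norm_of_nonneg (Real.exp_pos _).le]
    exact hpt ω
  refine ⟨hexpint, (integral_mono hexpint hbint hpt).trans ?_⟩
  have hlin : Integrable (fun ω => 1 + θ * Y ω) μ := (integrable_const 1).add (hYint.const_mul θ)
  rw [integral_add hlin (hint.const_mul _),
    integral_add (integrable_const 1) (hYint.const_mul θ), integral_const_mul, integral_const_mul,
    h0]
  simp only [integral_const, probReal_univ, smul_eq_mul, mul_one, mul_zero, add_zero]
  have h1 := Real.add_one_le_exp (24 * (θ * β) ^ 2)
  have h2 := mul_le_mul_of_nonneg_left hle (by positivity : 0 ≤ 8 * (θ * β) ^ 2)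
  linarith

/-- Two-sided Bernstein inequality for sums of i.i.d.-like centred sub-exponential variables. -/
theorem measureReal_abs_sum_ge_le {m : ℕ} {Y : Fin m → Ω → ℝ} (hY : ∀ j, Measurable (Y j))
    (hind : iIndepFun Y μ) (h0 : ∀ j, ∫ ω, Y j ω ∂μ = 0) {β : ℝ} (hβ : 1 ≤ β)
    (hint : ∀ j, Integrable (fun ω => Real.exp (|Y j ω| / β)) μ)
    (hle : ∀ j, ∫ ω, Real.exp (|Y j ω| / β) ∂μ ≤ 3) {τ : ℝ} (hτ0 : 0 < τ) (hτ1 : τ ≤ 1) :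
    μ.real {ω | m * τ ≤ |∑ j, Y j ω|} ≤ 2 * Real.exp (-(m * τ ^ 2 / (96 * β ^ 2))) := by
  have hβ0 : 0 < β := by linarith
  -- Minimises `-θ τ + 24 θ² β²`; it is admissible because `τ ≤ 1 ≤ β`.
  set θ := τ / (48 * β ^ 2) with hθ
  have hθ0 : 0 < θ := by positivity
  have hθβ : θ * β ≤ 1 / 2 := by
    have e : θ * β = τ / (48 * β) := by rw [hθ]; field_simp
    rw [e, div_le_iff₀ (by positivity)]
    linarith
  have hval : -θ * (m * τ) + m * (24 * (θ * β) ^ 2) = -(m * τ ^ 2 / (96 * β ^ 2)) := by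
    rw [hθ]
    field_simp
    ring
  have hmgf : ∀ u : ℝ, |u| = θ → Integrable (fun ω => Real.exp (u * (∑ j, Y j) ω)) μ ∧
      mgf (∑ j, Y j) μ u ≤ Real.exp (m * (24 * (θ * β) ^ 2)) := by
    intro u hu
    have hj := fun j => integral_exp_mul_le (hY j) (h0 j) hβ0 (hint j) (hle j) (θ := u)
      (by rw [hu]; exact hθβ)
    refine ⟨hind.integrable_exp_mul_sum hY fun j _ => (hj j).1, ?_⟩
    rw [hind.mgf_sum hY, Real.exp_nat_mul]
    have hu2 : (u * β) ^ 2 = (θ * β) ^ 2 := by rw [mul_pow, mul_pow, ← sq_abs u, hu]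
    calc ∏ j, mgf (Y j) μ u ≤ ∏ _j : Fin m, Real.exp (24 * (θ * β) ^ 2) := by
          refine Finset.prod_le_prod (fun j _ => mgf_nonneg) fun j _ => ?_
          rw [← hu2]
          exact (hj j).2
      _ = _ := by simp
  have h1 := (measure_ge_le_exp_mul_mgf (m * τ) hθ0.le (hmgf θ (abs_of_pos hθ0)).1).trans
    (mul_le_mul_of_nonneg_left (hmgf θ (abs_of_pos hθ0)).2 (Real.exp_pos _).le)
  have h2 := (measure_le_le_exp_mul_mgf (-(m * τ)) (neg_nonpos.2 hθ0.le)
    (hmgf (-θ) (by rw [abs_neg, abs_of_pos hθ0])).1).trans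
    (mul_le_mul_of_nonneg_left (hmgf (-θ) (by rw [abs_neg, abs_of_pos hθ0])).2
      (Real.exp_pos _).le)
  rw [← Real.exp_add, hval] at h1
  rw [neg_neg, ← Real.exp_add, show θ * -(m * τ) = -θ * (m * τ) by ring, hval] at h2
  have hsub : {ω | m * τ ≤ |∑ j, Y j ω|}
      ⊆ {ω | m * τ ≤ (∑ j, Y j) ω} ∪ {ω | (∑ j, Y j) ω ≤ -(m * τ)} := by
    intro ω hω
    simp only [Set.mem_union, Set.mem_ofPred_eq, Finset.sum_apply] at hω ⊢
    rcases le_abs'.1 hω with h | h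
    · exact Or.inr h
    · exact Or.inl h
  calc _ ≤ _ := (measureReal_mono hsub).trans (measureReal_union_le _ _)
    _ ≤ _ := add_le_add h1 h2
    _ = _ := by ring

open Measure in
/-- The rows of an array of independent random variables are independent. -/
lemma iIndepFun_curry {ι κ : Type*} {X : ι → κ → Ω → ℝ} (mX : ∀ i j, Measurable (X i j))
    (h : iIndepFun (fun (p : ι × κ) ω => X p.1 p.2 ω) μ) : iIndepFun (fun i ω j => X i j ω) μ := by
  have hpr : ∀ i j, IsProbabilityMeasure (μ.map (X i j)) :=
    fun i j => isProbabilityMeasure_map (mX i j).aemeasurable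
  have hrow : ∀ i, iIndepFun (X i) μ := fun i =>
    h.precomp (g := fun j => (i, j)) fun j j' hjj => (Prod.ext_iff.1 hjj).2
  have hcomp : (fun ω i j => X i j ω)
      = (MeasurableEquiv.curry ι κ ℝ) ∘ (fun ω (p : ι × κ) => X p.1 p.2 ω) := by
    ext
    simp
  have hm1 : Measurable (fun ω (p : ι × κ) => X p.1 p.2 ω) :=
    measurable_pi_lambda _ fun p => mX p.1 p.2
  -- Independence is expressed as a product law; the product law over pairs is regrouped into a
  -- product of row laws by currying.
  rw [iIndepFun_iff_map_fun_eq_infinitePi_map (fun i => measurable_pi_lambda _ fun j => mX i j),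
    hcomp, ← Measure.map_map (MeasurableEquiv.measurable _) hm1,
    (iIndepFun_iff_map_fun_eq_infinitePi_map (X := fun (p : ι × κ) ω => X p.1 p.2 ω)
      fun p => mX p.1 p.2).1 h,
    infinitePi_map_curry (fun i j => μ.map (X i j))]
  congr 1
  funext i
  exact ((iIndepFun_iff_map_fun_eq_infinitePi_map (mX i)).1 (hrow i)).symm

end SubGaussian

/-! ### Linear and bilinear forms in one row of the sketch. -/

section RowForms

variable {Ω : Type*} [MeasurableSpace Ω] {μ : Measure Ω}

lemma hasSubgaussianMGF_mono {X : Ω → ℝ} {c c' : NNReal} (h : HasSubgaussianMGF X c μ)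
    (hc : c ≤ c') : HasSubgaussianMGF X c' μ :=
  ⟨h.integrable_exp_mul, fun t => (h.mgf_le t).trans (by gcongr)⟩

variable {N : ℕ} {X : Fin N → Ω → ℝ}

lemma integral_linearForm_mul (hX : ∀ i, Measurable (X i)) (hind : iIndepFun X μ)
    (hL2 : ∀ i, MemLp (X i) 2 μ) (h0 : ∀ i, ∫ ω, X i ω ∂μ = 0)
    (h1 : ∀ i, ∫ ω, X i ω ^ 2 ∂μ = 1) (w w' : Fin N → ℝ) :
    ∫ ω, (∑ i, w i * X i ω) * (∑ i, w' i * X i ω) ∂μ = w ⬝ᵥ w' := by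
  have hint : ∀ i l, Integrable (fun ω => X i ω * X l ω) μ := fun i l => (hL2 i).integrable_mul (hL2 l)
  have hval : ∀ i l, ∫ ω, X i ω * X l ω ∂μ = if i = l then 1 else 0 := by
    intro i l
    split_ifs with hil
    · subst hil
      rw [← h1 i]
      simp only [sq]
    · have := (hind.indepFun hil).integral_fun_mul_eq_mul_integral (hX i).aestronglyMeasurable
        (hX l).aestronglyMeasurable
      rw [this, h0, zero_mul]
  have e : ∀ ω, (∑ i, w i * X i ω) * (∑ i, w' i * X i ω)
      = ∑ i, ∑ l, (w i * w' l) * (X i ω * X l ω) := by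
    intro ω
    rw [Finset.sum_mul_sum]
    exact Finset.sum_congr rfl fun i _ => Finset.sum_congr rfl fun l _ => by ring
  simp only [e]
  rw [integral_finsetSum _ fun i _ => integrable_finsetSum _ fun l _ => (hint i l).const_mul _]
  refine Finset.sum_congr rfl fun i _ => ?_
  rw [integral_finsetSum _ fun l _ => (hint i l).const_mul _]
  simp only [integral_const_mul, hval]
  simp

variable [IsProbabilityMeasure μ]

lemma integral_exp_linearForm_sq_le (hX : ∀ i, Measurable (X i)) (hind : iIndepFun X μ)
    {σ : NNReal} (hσ : 0 < σ) (hsub : ∀ i, HasSubgaussianMGF (X i) σ μ) {w : Fin N → ℝ}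
    (hw : w ⬝ᵥ w ≤ 4) :
    Integrable (fun ω => Real.exp ((∑ i, w i * X i ω) ^ 2 / (16 * σ))) μ ∧
      ∫ ω, Real.exp ((∑ i, w i * X i ω) ^ 2 / (16 * σ)) ∂μ ≤ 2 := by
  have hind' : iIndepFun (fun i ω => w i * X i ω) μ :=
    hind.comp (fun i x => w i * x) fun i => measurable_const_mul _
  have h1 := HasSubgaussianMGF.sum_of_iIndepFun hind' (s := Finset.univ)
    (fun i _ => (hsub i).const_mul (w i))
  have hle : ∑ i, w i ^ 2 * (σ : ℝ) ≤ 4 * σ := by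
    rw [← Finset.sum_mul]
    gcongr
    exact (Finset.sum_congr rfl fun i _ => sq (w i)).trans_le hw
  have h2 := lintegral_exp_sq_le (by fun_prop) (show 0 < 4 * σ by positivity)
    (hasSubgaussianMGF_mono h1 (by
      rw [← NNReal.coe_le_coe]
      push_cast
      exact hle))
  have e : 4 * ((4 * σ : NNReal) : ℝ) = 16 * σ := by
    push_cast
    ring
  rw [e] at h2
  exact integrable_and_integral_le_of_lintegral_le (by fun_prop) (fun ω => (Real.exp_pos _).le)
    zero_le_two (h2.trans_eq (by simp))

/-- The product of two linear forms of a sub-Gaussian vector is sub-exponential. -/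
lemma exp_abs_bilinear_le (hX : ∀ i, Measurable (X i)) (hind : iIndepFun X μ)
    {σ : NNReal} (hσ : 8 ≤ σ) (hsub : ∀ i, HasSubgaussianMGF (X i) σ μ) {w w' : Fin N → ℝ}
    (hw : w ⬝ᵥ w ≤ 4) (hw' : w' ⬝ᵥ w' ≤ 4) :
    Integrable (fun ω => Real.exp
      (|(∑ i, w i * X i ω) * (∑ i, w' i * X i ω) - w ⬝ᵥ w'| / (16 * σ))) μ ∧
    ∫ ω, Real.exp
      (|(∑ i, w i * X i ω) * (∑ i, w' i * X i ω) - w ⬝ᵥ w'| / (16 * σ)) ∂μ ≤ 3 := by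
  have hσ' : (8 : ℝ) ≤ σ := by exact_mod_cast hσ
  have hσ0 : 0 < σ := lt_of_lt_of_le (by norm_num) hσ
  obtain ⟨i1, l1⟩ := integral_exp_linearForm_sq_le hX hind hσ0 hsub hw
  obtain ⟨i2, l2⟩ := integral_exp_linearForm_sq_le hX hind hσ0 hsub hw'
  have hww : |w ⬝ᵥ w'| ≤ 4 := by
    have h := Finset.sum_mul_sq_le_sq_mul_sq Finset.univ w w'
    have h2 : (w ⬝ᵥ w') ^ 2 ≤ (w ⬝ᵥ w) * (w' ⬝ᵥ w') := by simpa [dotProduct, sq] using h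
    have h3 : 0 ≤ w' ⬝ᵥ w' := Finset.sum_nonneg fun i _ => mul_self_nonneg _
    refine abs_le_of_sq_le_sq ?_ (by norm_num)
    calc _ ≤ _ := h2
      _ ≤ 4 * 4 := by gcongr
      _ = 4 ^ 2 := by norm_num
  have hexp : Real.exp (1 / 32) ≤ 3 / 2 := by
    have h1 := (abs_le.1 (Real.abs_exp_sub_one_sub_id_le (x := 1 / 32) (by
      rw [abs_of_pos] <;> norm_num))).2
    norm_num at h1 ⊢
    linarith
  have hpt : ∀ a b : ℝ, Real.exp (|a * b - w ⬝ᵥ w'| / (16 * σ))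
      ≤ 3 / 4 * (Real.exp (a ^ 2 / (16 * σ)) + Real.exp (b ^ 2 / (16 * σ))) := by
    intro a b
    have h1 : |a * b - w ⬝ᵥ w'| ≤ (a ^ 2 + b ^ 2) / 2 + 4 := by
      refine (abs_sub _ _).trans (add_le_add ?_ hww)
      rw [abs_mul]
      nlinarith [sq_nonneg (|a| - |b|), sq_abs a, sq_abs b]
    -- `8 ≤ σ` makes the deterministic shift at most `1/32`, which costs a factor below `3/2`; the
    -- final bound is `3/4 * (2 + 2) = 3`.
    have h2 : |a * b - w ⬝ᵥ w'| / (16 * σ)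
        ≤ 1 / 32 + (a ^ 2 / (16 * σ) / 2 + b ^ 2 / (16 * σ) / 2) := by
      have h3 : 4 / (16 * (σ : ℝ)) ≤ 1 / 32 := by
        rw [div_le_div_iff₀ (by positivity) (by norm_num)]
        linarith
      calc _ ≤ ((a ^ 2 + b ^ 2) / 2 + 4) / (16 * σ) := by gcongr
        _ = 4 / (16 * (σ : ℝ)) + (a ^ 2 / (16 * σ) / 2 + b ^ 2 / (16 * σ) / 2) := by ring
        _ ≤ _ := by gcongr
    have hcv := convexOn_exp.2 (Set.mem_univ (a ^ 2 / (16 * σ))) (Set.mem_univ (b ^ 2 / (16 * σ)))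
      (show (0 : ℝ) ≤ 1 / 2 by norm_num) (show (0 : ℝ) ≤ 1 / 2 by norm_num) (by norm_num)
    have e : (1 / 2 : ℝ) • (a ^ 2 / (16 * σ)) + (1 / 2 : ℝ) • (b ^ 2 / (16 * σ))
        = a ^ 2 / (16 * σ) / 2 + b ^ 2 / (16 * σ) / 2 := by
      simp only [smul_eq_mul]
      ring
    rw [e] at hcv
    calc _ ≤ Real.exp (1 / 32) * Real.exp (a ^ 2 / (16 * σ) / 2 + b ^ 2 / (16 * σ) / 2) := by
          rw [← Real.exp_add]
          exact Real.exp_le_exp.2 h2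
      _ ≤ 3 / 2 * ((1 / 2 : ℝ) • Real.exp (a ^ 2 / (16 * σ))
          + (1 / 2 : ℝ) • Real.exp (b ^ 2 / (16 * σ))) := by gcongr
      _ = _ := by
          simp only [smul_eq_mul]
          ring
  have hbint := (i1.add i2).const_mul (3 / 4)
  have hint : Integrable (fun ω => Real.exp
      (|(∑ i, w i * X i ω) * (∑ i, w' i * X i ω) - w ⬝ᵥ w'| / (16 * σ))) μ := by
    refine Integrable.mono' hbint (by fun_prop) (Filter.Eventually.of_forall fun ω => ?_)
    rw [Real.norm_of_nonneg (Real.exp_pos _).le]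
    exact hpt _ _
  refine ⟨hint, (integral_mono hint hbint fun ω => hpt _ _).trans ?_⟩
  rw [integral_const_mul]
  have := integral_add i1 i2
  simp only [Pi.add_apply]
  rw [this]
  linarith

end RowForms

/-! ### Concentration of sketched inner products. -/

section Sketch

variable {Ω : Type*} [MeasurableSpace Ω] {μ : Measure Ω} {m N : ℕ} {K : ℝ}
  {S : Ω → Matrix (Fin m) (Fin N) ℝ}

lemma IsSubGaussianSketch.integral_sq (hS : IsSubGaussianSketch μ K S) (hm : 0 < m)
    (j : Fin m) (i : Fin N) : ∫ ω, (√m * S ω j i) ^ 2 ∂μ = 1 := by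
  have hm' : (0 : ℝ) < m := by exact_mod_cast hm
  have h := hS.variance_eq j i
  rw [variance_of_integral_eq_zero (hS.measurable j i).aemeasurable (hS.mean_zero j i)] at h
  simp only [mul_pow, Real.sq_sqrt hm'.le]
  rw [integral_const_mul, h]
  field_simp

variable [IsProbabilityMeasure μ]

lemma IsSubGaussianSketch.hasSubgaussianMGF (hS : IsSubGaussianSketch μ K S) (hK : 1 ≤ K)
    (j : Fin m) (i : Fin N) :
    HasSubgaussianMGF (fun ω => √m * S ω j i) (Real.toNNReal (8 * K ^ 2)) μ := by
  have hmeas : Measurable fun ω => √m * S ω j i := (hS.measurable j i).const_mul _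
  -- The infimum defining the norm need not be known to be attained; doubling `K` gives a strict
  -- inequality and hence an admissible constant.
  have hlt : subGaussianNorm (fun ω => √m * S ω j i) μ < ENNReal.ofReal (2 * K) :=
    (hS.norm_le j i).trans_lt ((ENNReal.ofReal_lt_ofReal_iff (by linarith)).2 (by linarith))
  obtain ⟨c, ⟨K', hK', rfl, hle⟩, hlt⟩ := sInf_lt_iff.1 hlt
  have hKK : K' < 2 * K := (ENNReal.ofReal_lt_ofReal_iff (by linarith)).1 hlt
  have hle2 : ∫⁻ ω, ENNReal.ofReal (Real.exp ((√m * S ω j i) ^ 2 / (2 * K) ^ 2)) ∂μ ≤ 2 := by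
    refine (lintegral_mono fun ω => ?_).trans hle
    gcongr
  obtain ⟨h1, h2⟩ := integrable_and_integral_le_of_lintegral_le (by fun_prop)
    (fun ω => (Real.exp_pos _).le) zero_le_two (hle2.trans_eq (by simp))
  refine hasSubgaussianMGF_of_exp_sq hmeas ?_ (by linarith : 0 < 2 * K) h1 h2 ?_
  · rw [integral_const_mul, hS.mean_zero, mul_zero]
  · rw [Real.coe_toNNReal _ (by positivity)]
    exact le_of_eq (by ring)

/-- Concentration of a sketched inner product. -/
theorem IsSubGaussianSketch.measureReal_abs_dotProduct_sub_ge_le (hS : IsSubGaussianSketch μ K S)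
    (hK : 1 ≤ K) (hm : 0 < m) {w w' : Fin N → ℝ} (hw : w ⬝ᵥ w ≤ 4) (hw' : w' ⬝ᵥ w' ≤ 4) {τ : ℝ}
    (hτ0 : 0 < τ) (hτ1 : τ ≤ 1) :
    μ.real {ω | τ ≤ |(S ω *ᵥ w) ⬝ᵥ (S ω *ᵥ w') - w ⬝ᵥ w'|}
      ≤ 2 * Real.exp (-(m * τ ^ 2 / (1572864 * K ^ 4))) := by
  have hm' : (0 : ℝ) < m := by exact_mod_cast hm
  set X : Fin m → Fin N → Ω → ℝ := fun j i ω => √m * S ω j i with hX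
  have mX : ∀ j i, Measurable (X j i) := fun j i => (hS.measurable j i).const_mul _
  have hind : iIndepFun (fun (p : Fin m × Fin N) ω => X p.1 p.2 ω) μ :=
    hS.indep.comp (fun _ x => √m * x) fun _ => measurable_const_mul _
  have hrow : ∀ j, iIndepFun (X j) μ := fun j =>
    hind.precomp (g := fun i => (j, i)) fun i i' hi => (Prod.ext_iff.1 hi).2
  set σ := Real.toNNReal (8 * K ^ 2) with hσ
  have hσr : (σ : ℝ) = 8 * K ^ 2 := Real.coe_toNNReal _ (by positivity)
  have hK2 : 1 ≤ K ^ 2 := one_le_pow₀ hK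
  have hσ8 : 8 ≤ σ := by
    rw [← NNReal.coe_le_coe, hσr]
    push_cast
    linarith
  have hsub : ∀ j i, HasSubgaussianMGF (X j i) σ μ := hS.hasSubgaussianMGF hK
  set Y : Fin m → Ω → ℝ := fun j ω =>
    (∑ i, w i * X j i ω) * (∑ i, w' i * X j i ω) - w ⬝ᵥ w' with hY
  have hYm : ∀ j, Measurable (Y j) := fun j => by fun_prop
  have hYind : iIndepFun Y μ :=
    (iIndepFun_curry mX hind).comp
      (fun _ x => (∑ i, w i * x i) * (∑ i, w' i * x i) - w ⬝ᵥ w') fun _ => by fun_prop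
  have hL2 : ∀ j i, MemLp (X j i) 2 μ := fun j i => by
    simpa using (hsub j i).memLp 2
  have hL2w : ∀ j (u : Fin N → ℝ), MemLp (fun ω => ∑ i, u i * X j i ω) 2 μ := fun j u =>
    memLp_finsetSum _ fun i _ => (hL2 j i).const_mul _
  have hY0 : ∀ j, ∫ ω, Y j ω ∂μ = 0 := by
    intro j
    have hi : Integrable (fun ω => (∑ i, w i * X j i ω) * (∑ i, w' i * X j i ω)) μ :=
      (hL2w j w).integrable_mul (hL2w j w')
    rw [hY]
    simp only
    rw [integral_sub hi (integrable_const _), integral_linearForm_mul (mX j) (hrow j) (hL2 j)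
      (fun i => by rw [hX]; simp only; rw [integral_const_mul, hS.mean_zero, mul_zero])
      (fun i => hS.integral_sq hm j i)]
    simp
  have hYe := fun j => exp_abs_bilinear_le (mX j) (hrow j) hσ8 (hsub j) hw hw'
  -- The scale is `β = 16 σ = 128 K²`, and `96 * 128² = 1572864`.
  have h1 := measureReal_abs_sum_ge_le hYm hYind hY0 (β := 16 * σ) (by rw [hσr]; linarith)
    (fun j => (hYe j).1) (fun j => (hYe j).2) hτ0 hτ1
  have hmul : ∀ ω (u : Fin N → ℝ) j, ∑ i, u i * X j i ω = √m * (S ω *ᵥ u) j := by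
    intro ω u j
    rw [mulVec, dotProduct, Finset.mul_sum]
    exact Finset.sum_congr rfl fun i _ => by rw [hX]; ring
  have hsum : ∀ ω, ∑ j, Y j ω = m * ((S ω *ᵥ w) ⬝ᵥ (S ω *ᵥ w') - w ⬝ᵥ w') := by
    intro ω
    rw [hY]
    simp only [hmul, Finset.sum_sub_distrib, Finset.sum_const, Finset.card_univ, Fintype.card_fin,
      nsmul_eq_mul, mul_sub]
    congr 1
    rw [dotProduct, Finset.mul_sum]
    refine Finset.sum_congr rfl fun j _ => ?_
    rw [mul_mul_mul_comm, Real.mul_self_sqrt hm'.le]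
  have hset : {ω | τ ≤ |(S ω *ᵥ w) ⬝ᵥ (S ω *ᵥ w') - w ⬝ᵥ w'|} = {ω | m * τ ≤ |∑ j, Y j ω|} := by
    ext ω
    simp only [Set.mem_ofPred_eq, hsum, abs_mul, abs_of_pos hm']
    exact (mul_le_mul_iff_right₀ hm').symm
  rw [hset]
  refine h1.trans_eq ?_
  rw [hσr]
  congr 3
  ring

end Sketch

/-! ### From a grid to all vectors. -/

section Net

/-- Coordinatewise the difference of the two sides is `(a + 5b)² / 4`. -/
lemma dotProduct_self_le_add {n : Type*} [Fintype n] (a b : n → ℝ) :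
    a ⬝ᵥ a ≤ 5 / 4 * ((a + b) ⬝ᵥ (a + b)) + 5 * (b ⬝ᵥ b) := by
  simp only [dotProduct, Finset.mul_sum, ← Finset.sum_add_distrib, Pi.add_apply]
  exact Finset.sum_le_sum fun i _ => by nlinarith [sq_nonneg (a i + 5 * b i)]

lemma dotProduct_mulVec_self_le {m n : Type*} [Fintype m] [Fintype n] (M : Matrix m n ℝ)
    (u : n → ℝ) : (M *ᵥ u) ⬝ᵥ (M *ᵥ u) ≤ (∑ k, ∑ j, M j k ^ 2) * (u ⬝ᵥ u) := by
  rw [Finset.sum_comm, Finset.sum_mul, dotProduct]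
  refine Finset.sum_le_sum fun j _ => ?_
  have := Finset.sum_mul_sq_le_sq_mul_sq Finset.univ (M j) u
  simpa [mulVec, dotProduct, sq] using this

/-- The points of the grid with mesh `1 / (20 r)` in the cube `[-1, 1]^r`. -/
noncomputable def gridNet (r : ℕ) : Finset (Fin r → ℤ) :=
  Fintype.piFinset fun _ => Finset.Icc (-(20 * r : ℤ)) (20 * r)

/-- The point of the grid with the given integer coordinates. -/
noncomputable def gridPoint (r : ℕ) (z : Fin r → ℤ) : Fin r → ℝ := fun k => z k / (20 * r)

lemma card_gridNet (r : ℕ) : (gridNet r).card = (40 * r + 1) ^ r := by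
  rw [gridNet, Fintype.card_piFinset]
  simp only [Int.card_Icc, Finset.prod_const, Finset.card_univ, Fintype.card_fin]
  congr 1
  omega

/-- A matrix that almost preserves the norms of the grid points is bounded below. -/
theorem half_le_of_gridNet {m r : ℕ} (hr : 0 < r) {M : Matrix (Fin m) (Fin r) ℝ}
    (h : ∀ z ∈ gridNet r, gridPoint r z ⬝ᵥ gridPoint r z ≤ 4 →
      |(M *ᵥ gridPoint r z) ⬝ᵥ (M *ᵥ gridPoint r z) - gridPoint r z ⬝ᵥ gridPoint r z| < 1 / 20)
    (v : Fin r → ℝ) : 1 / 2 * (v ⬝ᵥ v) ≤ (M *ᵥ v) ⬝ᵥ (M *ᵥ v) := by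
  have hr1 : (1 : ℝ) ≤ r := by exact_mod_cast hr
  have hr0 : (0 : ℝ) < r := by linarith
  -- The coordinate vectors are grid points, so the columns, and with them the Frobenius norm, are
  -- controlled without a separate event. That this norm may grow like `√r` is compensated by the
  -- mesh `1/(20 r)`.
  have hcol : ∀ k, ∑ j, M j k ^ 2 ≤ 21 / 20 := by
    intro k
    have e : gridPoint r (Pi.single k (20 * r : ℤ)) = Pi.single k 1 := by
      funext l
      rcases eq_or_ne l k with rfl | hl
      · simp only [gridPoint, Pi.single_eq_same]
        push_cast
        field_simp
      · simp [gridPoint, hl]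
    have h1 := h (Pi.single k (20 * r : ℤ)) (by
      rw [gridNet, Fintype.mem_piFinset]
      intro l
      rcases eq_or_ne l k with rfl | hl
      · simp
      · simp [hl]) (by rw [e]; simp)
    rw [e] at h1
    have h2 := (abs_lt.1 h1).2
    have e2 : (M *ᵥ Pi.single k 1) ⬝ᵥ (M *ᵥ Pi.single k 1) = ∑ j, M j k ^ 2 := by
      simp [dotProduct, sq]
    have e3 : (Pi.single k (1 : ℝ) : Fin r → ℝ) ⬝ᵥ Pi.single k 1 = 1 := by simp
    rw [e2, e3] at h2
    linarith
  have hF : ∑ k, ∑ j, M j k ^ 2 ≤ r * (21 / 20) := by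
    refine (Finset.sum_le_sum fun k _ => hcol k).trans_eq ?_
    simp
  have hunit : ∀ v : Fin r → ℝ, v ⬝ᵥ v = 1 → 1 / 2 ≤ (M *ᵥ v) ⬝ᵥ (M *ᵥ v) := by
    intro v hv
    have hT : (0 : ℝ) < 20 * r := by positivity
    set z : Fin r → ℤ := fun k => ⌊20 * r * v k⌋ with hz
    set w := gridPoint r z with hw
    set u := v - w with hu
    have hu1 : ∀ k, 0 ≤ u k ∧ u k ≤ 1 / (20 * r) := by
      -- Rounding down puts each coordinate of the error in `[0, 1/(20 r)]`.
      intro k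
      have h1 := Int.floor_le (20 * r * v k)
      have h2 := (Int.lt_floor_add_one (20 * r * v k)).le
      have e : u k = (20 * r * v k - z k) / (20 * r) := by
        rw [hu, Pi.sub_apply, hw, gridPoint]
        field_simp
      rw [e]
      exact ⟨div_nonneg (by linarith) hT.le, by gcongr; linarith⟩
    have huu : u ⬝ᵥ u ≤ 1 / (400 * r) := by
      calc u ⬝ᵥ u ≤ ∑ _k : Fin r, 1 / (20 * (r : ℝ)) * (1 / (20 * r)) :=
            Finset.sum_le_sum fun k _ => mul_le_mul (hu1 k).2 (hu1 k).2 (hu1 k).1 (by positivity)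
        _ = _ := by
            simp only [Finset.sum_const, Finset.card_univ, Fintype.card_fin, nsmul_eq_mul]
            field_simp
            norm_num
    have huu' : u ⬝ᵥ u ≤ 1 / 400 := huu.trans (by gcongr; linarith)
    have hMu : (M *ᵥ u) ⬝ᵥ (M *ᵥ u) ≤ 21 / 8000 := by
      calc _ ≤ _ := dotProduct_mulVec_self_le M u
        _ ≤ r * (21 / 20) * (1 / (400 * r)) := by
            refine mul_le_mul hF huu ?_ (by positivity)
            exact Finset.sum_nonneg fun i _ => mul_self_nonneg _
        _ = _ := by
            field_simp
            norm_num
    have hvw : v = w + u := by rw [hu]; abel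
    have hzmem : z ∈ gridNet r := by
      rw [gridNet, Fintype.mem_piFinset]
      intro k
      have hvk : v k ^ 2 ≤ 1 := by
        rw [← hv, dotProduct]
        simp only [← sq]
        exact Finset.single_le_sum (f := fun k => v k ^ 2) (fun j _ => sq_nonneg _)
          (Finset.mem_univ k)
      have hb := abs_le.1 ((sq_le_one_iff_abs_le_one _).1 hvk)
      rw [Finset.mem_Icc]
      refine ⟨Int.le_floor.2 ?_, Int.floor_le_iff.2 ?_⟩ <;> push_cast <;> nlinarith
    have h1 := dotProduct_self_le_add v (-u)
    have h2 := dotProduct_self_le_add w u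
    have h3 := dotProduct_self_le_add (M *ᵥ w) (M *ᵥ u)
    rw [← mulVec_add] at h3
    rw [← hvw] at h2 h3
    rw [hv] at h1 h2
    have e4 : v + -u = w := by rw [hu]; abel
    rw [e4, neg_dotProduct_neg] at h1
    have h5 := (abs_lt.1 (h z hzmem (by rw [← hw]; linarith))).1
    rw [← hw] at h5
    linarith
  rcases eq_or_ne (v ⬝ᵥ v) 0 with h0 | h0
  · rw [h0, mul_zero]
    exact Finset.sum_nonneg fun i _ => mul_self_nonneg _
  have hv0 : 0 < v ⬝ᵥ v :=
    lt_of_le_of_ne (Finset.sum_nonneg fun i _ => mul_self_nonneg _) (Ne.symm h0)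
  set s := (√(v ⬝ᵥ v))⁻¹ with hs
  have hss : s * s * (v ⬝ᵥ v) = 1 := by
    rw [hs, ← mul_inv, Real.mul_self_sqrt hv0.le, inv_mul_cancel₀ hv0.ne']
  have h1 := hunit (s • v) (by
    rw [smul_dotProduct, dotProduct_smul, smul_eq_mul, smul_eq_mul, ← mul_assoc, hss])
  rw [mulVec_smul, smul_dotProduct, dotProduct_smul, smul_eq_mul, smul_eq_mul, ← mul_assoc] at h1
  calc 1 / 2 * (v ⬝ᵥ v) ≤ s * s * ((M *ᵥ v) ⬝ᵥ (M *ᵥ v)) * (v ⬝ᵥ v) := by gcongr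
    _ = (s * s * (v ⬝ᵥ v)) * ((M *ᵥ v) ⬝ᵥ (M *ᵥ v)) := by ring
    _ = _ := by rw [hss, one_mul]

end Net

/-! ### Sub-Gaussian sketches: union bounds and sample size. -/

section DenseSketch

variable {Ω : Type*} [MeasurableSpace Ω] {μ : Measure Ω} [IsProbabilityMeasure μ]
  {m N d r L : ℕ} {A : Matrix (Fin N) (Fin d) ℝ} {Q : Matrix (Fin N) (Fin r) ℝ}
  {b b' : EuclideanSpace ℝ (Fin N)} {S : Ω → Matrix (Fin m) (Fin N) ℝ} {K ε δ : ℝ}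

lemma IsSubGaussianSketch.measureReal_gridNet_le (hS : IsSubGaussianSketch μ K S) (hK : 1 ≤ K)
    (hm : 0 < m) (hQ : Qᵀ * Q = 1) :
    μ.real {ω | ¬ ∀ z ∈ gridNet r, gridPoint r z ⬝ᵥ gridPoint r z ≤ 4 →
      |((S ω * Q) *ᵥ gridPoint r z) ⬝ᵥ ((S ω * Q) *ᵥ gridPoint r z)
        - gridPoint r z ⬝ᵥ gridPoint r z| < 1 / 20}
      ≤ (40 * r + 1) ^ r * (2 * Real.exp (-(m / (629145600 * K ^ 4)))) := by
  have hK0 : 0 < K := by linarith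
  set F : (Fin r → ℤ) → Set Ω := fun z => {ω | gridPoint r z ⬝ᵥ gridPoint r z ≤ 4 ∧
    1 / 20 ≤ |((S ω * Q) *ᵥ gridPoint r z) ⬝ᵥ ((S ω * Q) *ᵥ gridPoint r z)
        - gridPoint r z ⬝ᵥ gridPoint r z|} with hF
  have hsub : {ω | ¬ ∀ z ∈ gridNet r, gridPoint r z ⬝ᵥ gridPoint r z ≤ 4 →
      |((S ω * Q) *ᵥ gridPoint r z) ⬝ᵥ ((S ω * Q) *ᵥ gridPoint r z)
        - gridPoint r z ⬝ᵥ gridPoint r z| < 1 / 20} ⊆ ⋃ z ∈ gridNet r, F z := by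
    intro ω hω
    simp only [Set.mem_ofPred_eq] at hω
    push Not at hω
    obtain ⟨z, hz, h4, hle⟩ := hω
    exact Set.mem_biUnion hz ⟨h4, hle⟩
  have hone : ∀ z, μ.real (F z) ≤ 2 * Real.exp (-(m / (629145600 * K ^ 4))) := by
    intro z
    by_cases h4 : gridPoint r z ⬝ᵥ gridPoint r z ≤ 4
    · have hQz := dotProduct_mulVec_of_orthonormal hQ (gridPoint r z)
      have h := hS.measureReal_abs_dotProduct_sub_ge_le hK hm (w := Q *ᵥ gridPoint r z)
        (w' := Q *ᵥ gridPoint r z) (by rwa [hQz]) (by rwa [hQz]) (τ := 1 / 20) (by norm_num)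
        (by norm_num)
      simp only [hQz, mulVec_mulVec] at h
      refine (measureReal_mono fun ω hω => hω.2).trans (h.trans_eq ?_)
      congr 3
      field_simp
      norm_num
    · have : F z = ∅ := by
        ext ω
        simp [hF, h4]
      rw [this, measureReal_empty]
      positivity
  calc _ ≤ _ := (measureReal_mono hsub (measure_ne_top μ _)).trans (measureReal_biUnion_finset_le _ _)
    _ ≤ ∑ _z ∈ gridNet r, 2 * Real.exp (-(m / (629145600 * K ^ 4))) :=
        Finset.sum_le_sum fun z _ => hone z
    _ = _ := by
        rw [Finset.sum_const, card_gridNet, nsmul_eq_mul]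
        push_cast
        ring

lemma IsSubGaussianSketch.measureReal_correlation_le (hS : IsSubGaussianSketch μ K S) (hK : 1 ≤ K)
    (hm : 0 < m) (hr : 0 < r) (hQ : Qᵀ * Q = 1) {h : Fin N → ℝ} (hh : Qᵀ *ᵥ h = 0)
    (hh1 : h ⬝ᵥ h = 1) (hε : 0 < ε) (hε1 : ε ≤ 1) :
    μ.real {ω | ¬ ∑ k, (((S ω * Q)ᵀ *ᵥ (S ω *ᵥ h)) k) ^ 2 ≤ ε / 2}
      ≤ r * (2 * Real.exp (-(m * ε / (3145728 * r * K ^ 4)))) := by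
  have hr1 : (1 : ℝ) ≤ r := by exact_mod_cast hr
  have hK0 : 0 < K := by linarith
  -- An equal share of `ε / 2 = 2 ε κ²`, `κ = 1/2`, for each column.
  set τ := √(ε / (2 * r)) with hτ
  have hτ2 : τ ^ 2 = ε / (2 * r) := Real.sq_sqrt (by positivity)
  have hτ1 : τ ≤ 1 := by
    refine Real.sqrt_le_one.2 ?_
    rw [div_le_one (by positivity)]
    linarith
  have hcol : ∀ ω k, ((S ω * Q)ᵀ *ᵥ (S ω *ᵥ h)) k
      = (S ω *ᵥ (Q *ᵥ Pi.single k 1)) ⬝ᵥ (S ω *ᵥ h) := by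
    intro ω k
    rw [mulVec_mulVec (Pi.single k 1), mulVec_single_one]
    rfl
  have hQk : ∀ k : Fin r, (Q *ᵥ Pi.single k 1) ⬝ᵥ (Q *ᵥ Pi.single k 1) = 1 := fun k => by
    rw [dotProduct_mulVec_of_orthonormal hQ]
    simp
  have hQh : ∀ k : Fin r, (Q *ᵥ Pi.single k 1) ⬝ᵥ h = 0 := fun k => by
    rw [dotProduct_comm, dotProduct_mulVec, ← mulVec_transpose, hh, zero_dotProduct]
  have hsub : {ω | ¬ ∑ k, (((S ω * Q)ᵀ *ᵥ (S ω *ᵥ h)) k) ^ 2 ≤ ε / 2}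
      ⊆ ⋃ k ∈ (Finset.univ : Finset (Fin r)), {ω | τ ≤
        |(S ω *ᵥ (Q *ᵥ Pi.single k 1)) ⬝ᵥ (S ω *ᵥ h) - (Q *ᵥ Pi.single k 1) ⬝ᵥ h|} := by
    intro ω hω
    by_contra hcon
    simp only [Set.mem_iUnion, not_exists, Set.mem_ofPred_eq, not_le, hQh, sub_zero] at hcon
    refine hω ?_
    calc ∑ k, (((S ω * Q)ᵀ *ᵥ (S ω *ᵥ h)) k) ^ 2 ≤ ∑ _k : Fin r, τ ^ 2 := by
          refine Finset.sum_le_sum fun k _ => ?_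
          rw [hcol, ← sq_abs]
          exact pow_le_pow_left₀ (abs_nonneg _) (hcon k (Finset.mem_univ k)).le 2
      _ = ε / 2 := by
          rw [hτ2]
          simp only [Finset.sum_const, Finset.card_univ, Fintype.card_fin, nsmul_eq_mul]
          field_simp
  calc _ ≤ _ := (measureReal_mono hsub (measure_ne_top μ _)).trans (measureReal_biUnion_finset_le _ _)
    _ ≤ ∑ _k : Fin r, 2 * Real.exp (-(m * τ ^ 2 / (1572864 * K ^ 4))) := by
        refine Finset.sum_le_sum fun k _ => ?_
        exact hS.measureReal_abs_dotProduct_sub_ge_le hK hm (by rw [hQk]; norm_num)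
          (by rw [hh1]; norm_num) (by positivity) hτ1
    _ = _ := by
        rw [hτ2, Finset.sum_const, Finset.card_univ, Fintype.card_fin, nsmul_eq_mul]
        congr 4
        field_simp
        norm_num

theorem pairCondition_subGaussian (hA : IsOrth A Q) (hL : 1 ≤ L) (hε : 0 < ε) (hε1 : ε ≤ 1)
    (hδ : 0 < δ) (hδ1 : δ ≤ 1) (hK : 1 ≤ K) (hS : IsSubGaussianSketch μ K S)
    (hm : 3774873600 * K ^ 4 / ε * d * Real.log (4 * d * L / δ) ≤ (m : ℝ)) :
    PairCondition μ S ε (δ / L) Q (diffVec Q b b') := by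
  rcases Nat.eq_zero_or_pos r with rfl | hr
  · exact pairCondition_of_isEmpty hε.le (by positivity) Q _
  have hrd := rank_le_of_isOrth hA
  have hd : 0 < d := hr.trans_le hrd
  have hd1 : (1 : ℝ) ≤ d := by exact_mod_cast hd
  have hr0 : (0 : ℝ) < r := by exact_mod_cast hr
  have hrd' : (r : ℝ) ≤ d := by exact_mod_cast hrd
  have hL1 : (1 : ℝ) ≤ L := by exact_mod_cast hL
  have hK0 : 0 < K := by linarith
  have hlog := one_le_log_four_mul hd hL hδ hδ1
  have hexp := card_mul_exp_neg_log hd hL hδ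
  have hexp4 : 4 * (d : ℝ) ≤ Real.exp (Real.log (4 * d * L / δ)) := by
    rw [Real.exp_log (by positivity), le_div_iff₀ hδ]
    calc 4 * (d : ℝ) * δ ≤ 4 * d * 1 := by gcongr
      _ ≤ 4 * d * L := by gcongr
  set ℓ := Real.log (4 * d * L / δ) with hℓ
  have hm0 : 0 < m := by
    have : (0 : ℝ) < m := lt_of_lt_of_le (by positivity) hm
    exact_mod_cast this
  have hmε : 3774873600 * K ^ 4 * d * ℓ ≤ m * ε := by
    calc _ = 3774873600 * K ^ 4 / ε * d * ℓ * ε := by field_simp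
      _ ≤ _ := by gcongr
  have hm1 : 3774873600 * K ^ 4 * d * ℓ ≤ m :=
    hmε.trans (mul_le_of_le_one_right (Nat.cast_nonneg m) hε1)
  have hE : (40 * (r : ℝ) + 1) ^ r * (2 * Real.exp (-(m / (629145600 * K ^ 4))))
      ≤ δ / L / 2 := by
    -- The constant is `3774873600 = 6 * 629145600`. Three of the six units of `d ℓ` pay for the
    -- size of the grid, because `40 r + 1 ≤ (4 d)³`; the rest give the failure probability.
    have h1 : 6 * (d * ℓ) ≤ m / (629145600 * K ^ 4) := by
      rw [le_div_iff₀ (by positivity)]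
      linarith
    have h2 : 40 * (r : ℝ) + 1 ≤ Real.exp (3 * ℓ) := by
      calc 40 * (r : ℝ) + 1 ≤ (4 * d) ^ 3 := by nlinarith [sq_nonneg ((d : ℝ) - 1)]
        _ ≤ Real.exp ℓ ^ 3 := by gcongr
        _ = _ := by rw [← Real.exp_nat_mul]; norm_num
    have h3 : (40 * (r : ℝ) + 1) ^ r ≤ Real.exp (3 * (d * ℓ)) := by
      calc _ ≤ Real.exp (3 * ℓ) ^ r := by gcongr
        _ = Real.exp (r * (3 * ℓ)) := by rw [← Real.exp_nat_mul]
        _ ≤ Real.exp (d * (3 * ℓ)) := by gcongr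
        _ = _ := by congr 1; ring
    have h4 : ℓ ≤ d * ℓ := le_mul_of_one_le_left (by linarith) hd1
    calc _ ≤ Real.exp (3 * (d * ℓ)) * (2 * Real.exp (-(6 * (d * ℓ)))) := by gcongr
      _ = 2 * Real.exp (3 * (d * ℓ) + -(6 * (d * ℓ))) := by rw [Real.exp_add]; ring
      _ ≤ 2 * Real.exp (-ℓ) := by
          gcongr
          linarith
      _ = δ / L / (2 * d) := by rw [hexp]; field_simp; norm_num
      _ ≤ δ / L / 2 := by
          gcongr
          linarith
  have hF : r * (2 * Real.exp (-(m * ε / (3145728 * r * K ^ 4)))) ≤ δ / L / 2 := by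
    have h1 : ℓ ≤ m * ε / (3145728 * r * K ^ 4) := by
      rw [le_div_iff₀ (by positivity)]
      calc ℓ * (3145728 * r * K ^ 4) ≤ ℓ * (3774873600 * d * K ^ 4) := by
            gcongr
            norm_num
        _ = 3774873600 * K ^ 4 * d * ℓ := by ring
        _ ≤ _ := hmε
    calc _ ≤ d * (2 * Real.exp (-ℓ)) := by gcongr
      _ = δ / L / 2 := by rw [hexp]; field_simp; norm_num
  have hE' := (hS.measureReal_gridNet_le hK hm0 hA.1).trans hE
  have hperp := transpose_mulVec_diffVec Q b b'
  rcases diffVec_dotProduct_self Q b b' with h0 | h1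
  · refine pairCondition_of_measureReal_le _ ∅ (fun ω hω _ => isGoodSketch_of_bounds
      (κ := 1 / 2) hε.le (by norm_num) hA.1 hperp (half_le_of_gridNet hr (not_not.1 hω)) ?_) ?_
    · simp [h0]
    · rw [measureReal_empty, add_zero]
      have : 0 < δ / L := by positivity
      exact hE'.trans (by linarith)
  · refine pairCondition_of_measureReal_le _ _ (fun ω hω hω' => isGoodSketch_of_bounds
      (κ := 1 / 2) hε.le (by norm_num) hA.1 hperp (half_le_of_gridNet hr (not_not.1 hω)) ?_)
      ((add_le_add hE' ((hS.measureReal_correlation_le hK hm0 hr hA.1 hperp h1 hε hε1).trans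
        hF)).trans_eq (by ring))
    rw [h1]
    exact (not_not.1 hω').trans_eq (by ring)

end DenseSketch

end SketchLS

theorem mainTheorem4 :
    -- dense sub-Gaussian sketches, with an absolute constant `C`
    (∃ C : ℝ, 0 < C ∧
      ∀ {Ω : Type*} [MeasurableSpace Ω] (μ : Measure Ω) [IsProbabilityMeasure μ]
        {m N d r L : ℕ} (A : Matrix (Fin N) (Fin d) ℝ) (Q : Matrix (Fin N) (Fin r) ℝ)
        (b b' : EuclideanSpace ℝ (Fin N)) (S : Ω → Matrix (Fin m) (Fin N) ℝ) (K ε δ : ℝ),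
        SketchLS.IsOrth A Q →
        b ∉ LinearMap.range A.toEuclideanLin →
        b' ∉ LinearMap.range A.toEuclideanLin →
        1 ≤ L → 0 < ε → ε ≤ 1 → 0 < δ → δ ≤ 1 → 1 ≤ K →
        SketchLS.IsSubGaussianSketch μ K S →
        C * K ^ 4 / ε * d * Real.log (4 * d * L / δ) ≤ (m : ℝ) →
        SketchLS.PairCondition μ S ε (δ / L) Q (SketchLS.diffVec Q b b')) ∧
    -- leverage score row sketches
    (∀ {Ω : Type*} [MeasurableSpace Ω] (μ : Measure Ω) [IsProbabilityMeasure μ]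
        {m N d r L : ℕ} (A : Matrix (Fin N) (Fin d) ℝ) (Q : Matrix (Fin N) (Fin r) ℝ)
        (b b' : EuclideanSpace ℝ (Fin N)) (S : Ω → Matrix (Fin m) (Fin N) ℝ) (ε δ : ℝ),
        SketchLS.IsOrth A Q →
        b ∉ LinearMap.range A.toEuclideanLin →
        b' ∉ LinearMap.range A.toEuclideanLin →
        1 ≤ L → 0 < ε → ε < 1 / 2 → 0 < δ → δ < 1 / 2 →
        SketchLS.IsLeverageScoreSketch μ Q S →
        (max (35 * d * Real.log (4 * d * L / δ)) (2 * d * L / (ε * δ)) ≤ (m : ℝ) →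
          SketchLS.PairCondition μ S ε (δ / L) Q (SketchLS.diffVec Q b b')) ∧
        (∀ C : ℝ, 0 < C →
          (∀ (i : Fin r) (j : Fin N), 0 < SketchLS.leverageScore Q j →
            d * |Q j i * SketchLS.diffVec Q b b' j| / SketchLS.leverageScore Q j ≤ C) →
          max 35 (4 * C ^ 2 / ε) * d * Real.log (4 * d * L / δ) ≤ (m : ℝ) →
          SketchLS.PairCondition μ S ε (δ / L) Q (SketchLS.diffVec Q b b'))) := by
  refine ⟨⟨3774873600, by norm_num, ?_⟩, ?_⟩
  · intro Ω _ μ _ m N d r L A Q b b' S K ε δ hA _ _ hL hε hε1 hδ hδ1 hK hS hm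
    exact SketchLS.pairCondition_subGaussian hA hL hε hε1 hδ hδ1 hK hS hm
  · intro Ω _ μ _ m N d r L A Q b b' S ε δ hA _ _ hL hε _ hδ hδ1 hS
    exact ⟨fun hm => SketchLS.pairCondition_leverage hA hL hε hδ hδ1 hS hm,
      fun C hC hb hm => SketchLS.pairCondition_leverage_of_bounded hA hL hε hδ hδ1 hS hC hb hm⟩
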